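/- Let $d\ge 0$, let $R$ be a $d\times d$ integer matrix which is expansive (all its complex eigenvalues have modulus $>1$), and let $B,L\subset\mathbb Z^d$ be finite sets with $0\in B\cap L$ and $\#B=\#L=N$. Assume that $(R,B,L)$ is a Hadamard triple, i.e. the matrix $\frac1{\sqrt N}\left[e^{2\pi i\langle R^{-1}b,\ell\rangle}\right]_{\ell\in L,\,b\in B}$ is unitary. For a finite set $A\subset\mathbb R^d$ let $\delta_A=\frac1{\#A}\sum_{a\in A}\delta_a$, and let $\mu_{R,B}=\delta_{R^{-1}B}*\delta_{R^{-2}B}*\delta_{R^{-3}B}*\cdots$ be the self-affine measure (the weak limit of the finite convolutions). A countable set $\Lambda\subset\mathbb R^d$ is a spectrum of a compactly supported Borel probability measure $\mu$ if $\{e^{2\pi i\langle\lambda,x\rangle}:\lambda\in\Lambda\}$ is an orthonormal basis of $L^2(\mu)$. Put $m_B(x)=\frac1{\#B}\sum_{b\in B}e^{2\pi i\langle b,x\rangle}$ and $\tau_\ell(x)=(R^T)^{-1}(x+\ell)$ for $x\in\mathbb R^d$, $\ell\in L$, and $\tau_{\ell_1\dots\ell_m}=\tau_{\ell_1}\circ\dots\circ\tau_{\ell_m}$.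 A closed set $K\subset\mathbb R^d$ is invariant if, for all $x\in K$ and $\ell\in L$, $|m_B(\tau_\ell(x))|>0$ implies $\tau_\ell(x)\in K$. A minimal compact invariant set is a non-empty compact invariant set with no non-empty proper compact invariant subset. For $m\ge1$ and $\ell_1,\dots,\ell_m\in L$, let $x_0$ be the fixed point of $\tau_{\ell_1\dots\ell_m}$; the cycle $\mathcal C(\ell_1,\dots,\ell_m)=\{x_0,\tau_{\ell_m}(x_0),\tau_{\ell_{m-1}\ell_m}(x_0),\dots,\tau_{\ell_2\dots\ell_m}(x_0)\}$ is called extreme if $|m_B|=1$ at each of its points, and its points are then called extreme cycle points. The triple $(R,B,L)$ is dynamically simple if every minimal compact invariant set is an extreme cycle. Let $\Lambda$ be the set generated by the extreme cycles: the smallest subset of $\mathbb R^d$ which contains $-\mathcal C$ for every extreme cycle $\mathcal C$ and satisfies $R^T\Lambda+L\subset\Lambda$. Then: (0) the infinite convolution defining $\mu_{R,B}$ converges weakly to a compactly supported Borel probability measure; (i) if $(R,B,L)$ is dynamically simple, then $\Lambda$ is a spectrum of $\mu_{R,B}$, and $$\Lambda=\{\ell_0+R^T\ell_1+\dots+(R^T)^{n-1}\ell_{n-1}+(R^T)^n(-c):\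 n\ge0,\ \ell_0,\dots,\ell_{n-1}\in L,\ c\text{ an extreme cycle point}\};$$ (ii) if $d=1$, then $(R,B,L)$ is dynamically simple. -/

import Mathlib

open MeasureTheory Filter Topology

noncomputable section

namespace Dyn

/-- An integer vector, seen in `ℝ^d`. -/
def toReal {d : ℕ} (v : Fin d → ℤ) : Fin d → ℝ := fun i => (v i : ℝ)

/-- An integer matrix, seen as a real matrix. -/
def realMat {d : ℕ} (R : Matrix (Fin d) (Fin d) ℤ) : Matrix (Fin d) (Fin d) ℝ :=
  R.map (fun a => (a : ℝ))

/-- All complex eigenvalues have modulus `> 1`. -/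
def IsExpansive {d : ℕ} (R : Matrix (Fin d) (Fin d) ℤ) : Prop :=
  ∀ z : ℂ, Module.End.HasEigenvalue (Matrix.toLin' (R.map (fun a => (a : ℂ)))) z → 1 < ‖z‖

/-- The matrix `(1/√N) [exp (2πi ⟨R⁻¹ b, ℓ⟩)]`, with rows `ℓ ∈ L` and columns `b ∈ B`, `N = #B`. -/
def hadamardMatrix {d : ℕ} (R : Matrix (Fin d) (Fin d) ℤ) (B L : Finset (Fin d → ℤ)) :
    Matrix {ℓ // ℓ ∈ L} {b // b ∈ B} ℂ :=
  fun ℓ b => (1 / (Real.sqrt (B.card : ℝ) : ℂ)) *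
    Complex.exp (2 * Real.pi * Complex.I *
      ((((realMat R)⁻¹.mulVec (toReal b.1)) ⬝ᵥ toReal ℓ.1 : ℝ) : ℂ))

/-- `(R, B, L)` is a Hadamard triple on `ℝ^d`. -/
structure IsHadamardTriple {d : ℕ} (R : Matrix (Fin d) (Fin d) ℤ)
    (B L : Finset (Fin d → ℤ)) : Prop where
  expansive : IsExpansive R
  zero_mem_B : (0 : Fin d → ℤ) ∈ B
  zero_mem_L : (0 : Fin d → ℤ) ∈ L
  card_eq : B.card = L.card
  unitary : (hadamardMatrix R B L).conjTranspose * hadamardMatrix R B L = 1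

/-! ### The self-affine measure -/

/-- The uniform probability measure `δ_A = (1/#A) ∑_{a ∈ A} δ_a` on a finite set `A`
(it is the zero measure if `A` is empty). -/
def discreteMeasure {d : ℕ} (A : Finset (Fin d → ℝ)) : Measure (Fin d → ℝ) :=
  ENNReal.ofReal (1 / (A.card : ℝ)) • ∑ a ∈ A, Measure.dirac a

instance {d : ℕ} (A : Finset (Fin d → ℝ)) : IsFiniteMeasure (discreteMeasure A) := by
  unfold discreteMeasure
  exact Measure.smul_finite _ ENNReal.ofReal_ne_top

open Classical in
/-- The finite set `R⁻ᵏ B ⊂ ℝ^d`. -/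
def scaledDigits {d : ℕ} (R : Matrix (Fin d) (Fin d) ℤ) (B : Finset (Fin d → ℤ)) (k : ℕ) :
    Finset (Fin d → ℝ) :=
  B.image fun b => ((realMat R)⁻¹ ^ k).mulVec (toReal b)

/-- `partialConv R B n = δ_{R⁻¹B} ∗ δ_{R⁻²B} ∗ ⋯ ∗ δ_{R⁻ⁿB}` (for `n = 0`: `δ_0`). -/
def partialConv {d : ℕ} (R : Matrix (Fin d) (Fin d) ℤ) (B : Finset (Fin d → ℤ)) :
    ℕ → Measure (Fin d → ℝ)
  | 0 => Measure.dirac 0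
  | n + 1 => Measure.conv (partialConv R B n) (discreteMeasure (scaledDigits R B (n + 1)))

instance instFinitePartialConv {d : ℕ} (R : Matrix (Fin d) (Fin d) ℤ)
    (B : Finset (Fin d → ℤ)) (n : ℕ) : IsFiniteMeasure (partialConv R B n) := by
  induction n with
  | zero => unfold partialConv; infer_instance
  | succ n ih => unfold partialConv; infer_instance

/-- The partial convolutions as elements of the space of finite Borel measures with the topology
of weak convergence. -/
def partialConvFinite {d : ℕ} (R : Matrix (Fin d) (Fin d) ℤ) (B : Finset (Fin d → ℤ)) (n : ℕ) :
    FiniteMeasure (Fin d → ℝ) :=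
  ⟨partialConv R B n, inferInstance⟩

/-- The self-affine measure `μ_{R,B} = δ_{R⁻¹B} ∗ δ_{R⁻²B} ∗ ⋯`, the weak limit of the partial
convolutions. -/
def selfAffineMeasure {d : ℕ} (R : Matrix (Fin d) (Fin d) ℤ) (B : Finset (Fin d → ℤ)) :
    FiniteMeasure (Fin d → ℝ) :=
  limUnder atTop (partialConvFinite R B)

/-! ### Spectra -/

/-- The exponential `x ↦ exp (2πi ⟨ξ, x⟩)`. -/
def expFun {d : ℕ} (ξ : Fin d → ℝ) (x : Fin d → ℝ) : ℂ :=
  Complex.exp (2 * Real.pi * Complex.I * ((ξ ⬝ᵥ x : ℝ) : ℂ))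

theorem norm_expFun {d : ℕ} (ξ x : Fin d → ℝ) : ‖expFun ξ x‖ = 1 := by
  have h : (2 * Real.pi * Complex.I * ((ξ ⬝ᵥ x : ℝ) : ℂ))
      = ((2 * Real.pi * (ξ ⬝ᵥ x) : ℝ) : ℂ) * Complex.I := by
    push_cast; ring
  rw [expFun, h, Complex.norm_exp_ofReal_mul_I]

theorem continuous_expFun {d : ℕ} (ξ : Fin d → ℝ) : Continuous (expFun ξ) := by
  unfold expFun dotProduct
  fun_prop

theorem memLp_expFun {d : ℕ} (ξ : Fin d → ℝ) (μ : Measure (Fin d → ℝ)) [IsFiniteMeasure μ] :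
    MemLp (expFun ξ) 2 μ :=
  MemLp.of_bound (continuous_expFun ξ).aestronglyMeasurable 1
    (Eventually.of_forall fun x => (norm_expFun ξ x).le)

/-- The exponential as an element of `L²(μ)`. -/
def expLp {d : ℕ} (μ : Measure (Fin d → ℝ)) [IsFiniteMeasure μ] (ξ : Fin d → ℝ) : Lp ℂ 2 μ :=
  (memLp_expFun ξ μ).toLp (expFun ξ)

/-- `Λ` is a spectrum of `μ`: it is countable, and the exponentials `exp (2πi ⟨λ, x⟩)`, `λ ∈ Λ`,
form an orthonormal basis of `L²(μ)`. -/
def IsSpectrum {d : ℕ} (Λ : Set (Fin d → ℝ)) (μ : Measure (Fin d → ℝ)) [IsFiniteMeasure μ] :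
    Prop :=
  Λ.Countable ∧ Orthonormal ℂ (fun ξ : Λ => expLp μ ξ.1) ∧
    (Submodule.span ℂ (Set.range fun ξ : Λ => expLp μ ξ.1)).topologicalClosure = ⊤

/-! ### The dynamical system -/

/-- `m_B (x) = (1/#B) ∑_{b ∈ B} exp (2πi ⟨b, x⟩)`. -/
def maskFun {d : ℕ} (B : Finset (Fin d → ℤ)) (x : Fin d → ℝ) : ℂ :=
  (1 / (B.card : ℂ)) * ∑ b ∈ B, expFun (toReal b) x

/-- `τ_ℓ (x) = (Rᵀ)⁻¹ (x + ℓ)`. -/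
def tau {d : ℕ} (R : Matrix (Fin d) (Fin d) ℤ) (ℓ : Fin d → ℤ) (x : Fin d → ℝ) : Fin d → ℝ :=
  ((realMat R).transpose)⁻¹.mulVec (x + toReal ℓ)

/-- `τ_{ℓ₁ ⋯ ℓₘ} = τ_{ℓ₁} ∘ ⋯ ∘ τ_{ℓₘ}` for the word `w = [ℓ₁, …, ℓₘ]`. -/
def tauWord {d : ℕ} (R : Matrix (Fin d) (Fin d) ℤ) (w : List (Fin d → ℤ)) (x : Fin d → ℝ) :
    Fin d → ℝ :=
  w.foldr (fun ℓ y => tau R ℓ y) x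

/-- A closed set `K` is invariant if every possible transition from a point of `K` stays in `K`;
the transition from `x` to `τ_ℓ x` is possible if `|m_B (τ_ℓ x)| > 0`. -/
def IsInvariant {d : ℕ} (R : Matrix (Fin d) (Fin d) ℤ) (B L : Finset (Fin d → ℤ))
    (K : Set (Fin d → ℝ)) : Prop :=
  IsClosed K ∧ ∀ x ∈ K, ∀ ℓ ∈ L, 0 < ‖maskFun B (tau R ℓ x)‖ → tau R ℓ x ∈ K

/-- Minimal (non-empty) compact invariant sets. -/
def IsMinimalCompactInvariant {d : ℕ} (R : Matrix (Fin d) (Fin d) ℤ)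
    (B L : Finset (Fin d → ℤ)) (M : Set (Fin d → ℝ)) : Prop :=
  (M.Nonempty ∧ IsCompact M ∧ IsInvariant R B L M) ∧
    ∀ K : Set (Fin d → ℝ), K.Nonempty → IsCompact K → IsInvariant R B L K → K ⊆ M → K = M

/-- `C` is the cycle `C(ℓ₁, …, ℓₘ) = {x₀, τ_{ℓₘ} x₀, τ_{ℓₘ₋₁ ℓₘ} x₀, …, τ_{ℓ₂ ⋯ ℓₘ} x₀}` of a word
`w = [ℓ₁, …, ℓₘ]`, `m ≥ 1`, with letters in `L`, where `x₀` is the fixed point of `τ_{ℓ₁ ⋯ ℓₘ}`: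
the images of `x₀` under `τ_v`, for all suffixes `v` of `w`. -/
def IsCycle {d : ℕ} (R : Matrix (Fin d) (Fin d) ℤ) (L : Finset (Fin d → ℤ))
    (C : Set (Fin d → ℝ)) : Prop :=
  ∃ w : List (Fin d → ℤ), w ≠ [] ∧ (∀ ℓ ∈ w, ℓ ∈ L) ∧
    ∃ x₀ : Fin d → ℝ, tauWord R w x₀ = x₀ ∧
      C = {y | ∃ v : List (Fin d → ℤ), v <:+ w ∧ y = tauWord R v x₀}

/-- Extreme cycles: cycles on which `|m_B| = 1`. -/
def IsExtremeCycle {d : ℕ} (R : Matrix (Fin d) (Fin d) ℤ) (B L : Finset (Fin d → ℤ))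
    (C : Set (Fin d → ℝ)) : Prop :=
  IsCycle R L C ∧ ∀ x ∈ C, ‖maskFun B x‖ = 1

/-- Extreme cycle points: the points of the extreme cycles. -/
def IsExtremeCyclePoint {d : ℕ} (R : Matrix (Fin d) (Fin d) ℤ) (B L : Finset (Fin d → ℤ))
    (c : Fin d → ℝ) : Prop :=
  ∃ C : Set (Fin d → ℝ), IsExtremeCycle R B L C ∧ c ∈ C

/-- The only minimal compact invariant sets are extreme cycles. -/
def IsDynamicallySimple {d : ℕ} (R : Matrix (Fin d) (Fin d) ℤ)
    (B L : Finset (Fin d → ℤ)) : Prop :=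
  ∀ M : Set (Fin d → ℝ), IsMinimalCompactInvariant R B L M → IsExtremeCycle R B L M

/-- The set generated by the extreme cycles: the smallest `Λ ⊆ ℝ^d` that contains `-C` for all
extreme cycles `C` and satisfies `Rᵀ Λ + L ⊆ Λ`. -/
def generatedSet {d : ℕ} (R : Matrix (Fin d) (Fin d) ℤ) (B L : Finset (Fin d → ℤ)) :
    Set (Fin d → ℝ) :=
  ⋂₀ {S | (∀ C, IsExtremeCycle R B L C → ∀ c ∈ C, -c ∈ S) ∧
    ∀ x ∈ S, ∀ ℓ ∈ L, (realMat R).transpose.mulVec x + toReal ℓ ∈ S}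

/-- The points `ℓ₀ + Rᵀ ℓ₁ + ⋯ + (Rᵀ)ⁿ⁻¹ ℓₙ₋₁ + (Rᵀ)ⁿ (-c)`, with `n ≥ 0`, `ℓ₀, …, ℓₙ₋₁ ∈ L` and
`c` an extreme cycle point. -/
def explicitSet {d : ℕ} (R : Matrix (Fin d) (Fin d) ℤ) (B L : Finset (Fin d → ℤ)) :
    Set (Fin d → ℝ) :=
  {x | ∃ (n : ℕ) (ℓ : Fin n → (Fin d → ℤ)) (c : Fin d → ℝ),
    (∀ k, ℓ k ∈ L) ∧ IsExtremeCyclePoint R B L c ∧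
    x = (∑ k : Fin n, ((realMat R).transpose ^ (k : ℕ)).mulVec (toReal (ℓ k))) +
      ((realMat R).transpose ^ n).mulVec (-c)}

end Dyn

end

namespace Dyn

section

open Matrix

variable {d : ℕ} {R : Matrix (Fin d) (Fin d) ℤ} {B L : Finset (Fin d → ℤ)}

/-! ### Powers of the inverse of an expansive matrix -/

/-! Write `S = Rᵀ`. Unitarity says that `∑_ℓ |m_B(τ_ℓ x)|² = 1`, so the numbers `|m_B(τ_ℓ x)|²` are
transition probabilities (`sum_norm_maskFun_tau_sq`). The measure satisfies `μ̂(ξ) = m_B(S⁻¹ξ)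
μ̂(S⁻¹ξ)` (`fourier_selfAffineMeasure`). Expansiveness is used only through the summable decay of
`R⁻ᵏ` and `S⁻ᵏ`, and it makes the random series of digits converge almost surely, which yields `μ`.

Orthogonality: every point of `Λ` pairs integrally with `B`, hence is a period of `m_B`, and has an
infinite expansion in digits of `L` whose remainders form a finite set. If `μ̂(x - y) ≠ 0`, the
digits of `x` and `y` agree at every step. So `S⁻ⁿ(x - y)` stays in a finite set while tending to
`0`, which forces `x = y`.

Completeness: `h(x) = ∑_{γ ∈ Λ} |μ̂(x + γ)|²` is a fixed point of the averaging operator of the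
transition probabilities, because `Λ` is the disjoint union of the sets `SΛ + ℓ`. It is lower
semicontinuous, so it attains a minimum on a compact set stable under all `τ_ℓ`. The points of
minimum form an invariant set, which contains a minimal one. By dynamical simplicity that is an
extreme cycle, and at a cycle point `c` the term `γ = -c` equals `1`. Hence `h ≥ 1`, which is
Parseval's identity for exponentials, and these are total by Stone–Weierstrass.

Dimension one: `m_B` has finitely many zeros in a bounded set. If a minimal set `M` misses `0`, no
orbit `S⁻ⁿx` can remain in `M`, so each point of `M` reaches a zero of `m_B` in boundedly many
steps, and `M` is finite. On a finite minimal set transitions are unique (`transition_unique`),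
hence have probability one, and `M` is a single periodic orbit. -/

theorem det_realMat_ne_zero (hR : IsExpansive R) : (realMat R).det ≠ 0 := by
  intro h
  have h0 : R.det = 0 := by
    have h1 := (Int.castRingHom ℝ).map_det R
    have h2 : (Int.castRingHom ℝ).mapMatrix R = realMat R := rfl
    rw [h2, h] at h1
    simpa using h1
  have hc : (R.map (fun a => (a : ℂ))).det = 0 := by
    have h1 := (Int.castRingHom ℂ).map_det R
    have h2 : (Int.castRingHom ℂ).mapMatrix R = R.map (fun a => (a : ℂ)) := rfl
    rw [h2, h0] at h1
    simpa using h1.symm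
  obtain ⟨v, hv, hv0⟩ := Matrix.exists_mulVec_eq_zero_iff.2 hc
  have h3 := hR 0 (Module.End.hasEigenvalue_of_hasEigenvector (x := v)
    ⟨Module.End.mem_eigenspace_iff.2 (by simpa using hv0), hv⟩)
  simp at h3
  linarith

theorem isUnit_det_realMat (hR : IsExpansive R) : IsUnit (realMat R).det :=
  (det_realMat_ne_zero hR).isUnit

theorem isUnit_det_transpose (hR : IsExpansive R) : IsUnit (realMat R)ᵀ.det := by
  rw [det_transpose]; exact isUnit_det_realMat hR

theorem transpose_mulVec_inv_mulVec (hR : IsExpansive R) (x : Fin d → ℝ) :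
    (realMat R)ᵀ *ᵥ (((realMat R)ᵀ)⁻¹ *ᵥ x) = x := by
  rw [mulVec_mulVec, mul_nonsing_inv _ (isUnit_det_transpose hR), one_mulVec]

theorem inv_mulVec_transpose_mulVec (hR : IsExpansive R) (x : Fin d → ℝ) :
    ((realMat R)ᵀ)⁻¹ *ᵥ ((realMat R)ᵀ *ᵥ x) = x := by
  rw [mulVec_mulVec, nonsing_inv_mul _ (isUnit_det_transpose hR), one_mulVec]

section

attribute [local instance] Matrix.linftyOpNormedAddCommGroup Matrix.linftyOpNormedRing
  Matrix.linftyOpNormedAlgebra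

theorem norm_entry_le_linftyOpNorm (M : Matrix (Fin d) (Fin d) ℂ) (i j : Fin d) :
    ‖M i j‖ ≤ ‖M‖ := by
  have h := Matrix.linfty_opNorm_mulVec M (Pi.single j 1)
  have h1 := norm_le_pi_norm (M *ᵥ Pi.single j 1) i
  rw [Matrix.mulVec_single_one] at h1
  have h2 : ‖(Pi.single j 1 : Fin d → ℂ)‖ ≤ 1 := by
    refine (pi_norm_le_iff_of_nonneg zero_le_one).2 fun k => ?_
    by_cases hk : k = j
    · subst hk; simp
    · simp [hk]
  rw [Matrix.mulVec_single_one] at h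
  calc ‖M i j‖ ≤ ‖M.col j‖ := h1
    _ ≤ ‖M‖ * ‖(Pi.single j 1 : Fin d → ℂ)‖ := h
    _ ≤ ‖M‖ * 1 := by gcongr
    _ = ‖M‖ := mul_one _

/-- By Gelfand's formula the powers are eventually dominated by `rᵏ` for any `r` strictly between
the spectral radius and `1`. -/
theorem summable_norm_pow_of_spectralRadius_lt_one (M : Matrix (Fin d) (Fin d) ℂ)
    (h : spectralRadius ℂ M < 1) : Summable fun k => ‖M ^ k‖ := by
  have hG := spectrum.pow_nnnorm_pow_one_div_tendsto_nhds_spectralRadius M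
  obtain ⟨r, hr, hr1⟩ := ENNReal.lt_iff_exists_nnreal_btwn.1 h
  have hr1' : r < 1 := by exact_mod_cast hr1
  have hev : ∀ᶠ k : ℕ in atTop, ‖‖M ^ k‖‖ ≤ (r : ℝ) ^ k := by
    filter_upwards [hG.eventually (gt_mem_nhds hr), eventually_gt_atTop 0] with k hk hk0
    have hk0' : (k : ℝ) ≠ 0 := by exact_mod_cast hk0.ne'
    have h1 : (‖M ^ k‖₊ : ENNReal) ≤ (r : ENNReal) ^ k := by
      have h2 := ENNReal.rpow_le_rpow hk.le (Nat.cast_nonneg k)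
      rw [← ENNReal.rpow_mul, one_div, inv_mul_cancel₀ hk0', ENNReal.rpow_one,
        ENNReal.rpow_natCast] at h2
      exact h2
    rw [norm_norm]
    exact_mod_cast h1
  exact Summable.of_norm_bounded_eventually_nat
    (summable_geometric_of_lt_one r.2 (by exact_mod_cast hr1')) hev

/-- The eigenvalues of the inverse are the reciprocals of those of `R`, so its spectral radius is
below `1`. Bounding entries, not a norm, lets the same sequence serve the transpose. -/
theorem exists_summable_inv_pow_entry_le (hR : IsExpansive R) :
    ∃ c : ℕ → ℝ, Summable c ∧ (∀ k, 0 ≤ c k) ∧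
      ∀ k i j, |((realMat R)⁻¹ ^ k) i j| ≤ c k := by
  -- For `d = 0` the matrix algebra is trivial and spectra are empty.
  rcases Nat.eq_zero_or_pos d with rfl | hd
  · exact ⟨0, summable_zero, fun _ => le_rfl, fun _ i => i.elim0⟩
  have : Nonempty (Fin d) := ⟨⟨0, hd⟩⟩
  set f : ℝ →+* ℂ := Complex.ofRealHom
  set M : Matrix (Fin d) (Fin d) ℂ := f.mapMatrix (realMat R)⁻¹ with hM
  set Q : Matrix (Fin d) (Fin d) ℂ := R.map (fun a => (a : ℂ)) with hQ
  have hQ' : Q = f.mapMatrix (realMat R) := by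
    ext i j; simp [hQ, realMat, f]
  have h1 : M * Q = 1 := by
    rw [hM, hQ', ← map_mul, nonsing_inv_mul _ (isUnit_det_realMat hR), map_one]
  have h2 : Q * M = 1 := by
    rw [hM, hQ', ← map_mul, mul_nonsing_inv _ (isUnit_det_realMat hR), map_one]
  let u : (Matrix (Fin d) (Fin d) ℂ)ˣ := ⟨Q, M, h2, h1⟩
  have hs : spectralRadius ℂ M < 1 := by
    have h3 : spectralRadius ℂ M < ((1 : NNReal) : ENNReal) := by
      refine spectrum.spectralRadius_lt_of_forall_lt M fun z hz => ?_
      have hz1 : z⁻¹ ∈ spectrum ℂ Q := by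
        have : z ∈ spectrum ℂ (↑u⁻¹ : Matrix (Fin d) (Fin d) ℂ) := hz
        exact spectrum.inv₀_mem_iff.2 this
      have h5 := hR z⁻¹ (by
        rw [Module.End.hasEigenvalue_iff_mem_spectrum]
        have : spectrum ℂ (Matrix.toLin' Q) = spectrum ℂ Q := Matrix.spectrum_toLin' Q
        rw [this]; exact hz1)
      rw [norm_inv] at h5
      have h6 : ‖z‖ < 1 := by
        by_contra hcon
        exact absurd h5 (not_lt.2 (inv_le_one_of_one_le₀ (not_lt.1 hcon)))
      exact_mod_cast h6
    simpa using h3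
  refine ⟨fun k => ‖M ^ k‖, summable_norm_pow_of_spectralRadius_lt_one M hs,
    fun k => norm_nonneg _, fun k i j => ?_⟩
  refine le_trans (le_of_eq ?_) (norm_entry_le_linftyOpNorm (M ^ k) i j)
  rw [hM, ← map_pow]
  simp [f]

end

theorem exists_summable_inv_pow_mulVec_le (hR : IsExpansive R) :
    ∃ c : ℕ → ℝ, Summable c ∧ (∀ k, 0 ≤ c k) ∧
      (∀ k v, ‖((realMat R)⁻¹ ^ k) *ᵥ v‖ ≤ c k * ‖v‖) ∧
      ∀ k v, ‖(((realMat R)ᵀ)⁻¹ ^ k) *ᵥ v‖ ≤ c k * ‖v‖ := by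
  obtain ⟨c, hc, hc0, hle⟩ := exists_summable_inv_pow_entry_le hR
  have key : ∀ (k : ℕ) (M : Matrix (Fin d) (Fin d) ℝ), (∀ i j, |M i j| ≤ c k) →
      ∀ v, ‖M *ᵥ v‖ ≤ d * c k * ‖v‖ := by
    intro k M hM v
    refine (pi_norm_le_iff_of_nonneg
      (mul_nonneg (mul_nonneg (Nat.cast_nonneg _) (hc0 k)) (norm_nonneg v))).2 fun i => ?_
    calc ‖(M *ᵥ v) i‖ ≤ ∑ j, ‖M i j * v j‖ :=
        norm_sum_le Finset.univ fun j => M i j * v j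
      _ ≤ ∑ _j : Fin d, c k * ‖v‖ := by
        refine Finset.sum_le_sum fun j _ => ?_
        rw [norm_mul]
        exact mul_le_mul (hM i j) (norm_le_pi_norm v j) (norm_nonneg _) (hc0 k)
      _ = d * c k * ‖v‖ := by simp [mul_assoc]
  refine ⟨fun k => d * c k, hc.mul_left _, fun k => mul_nonneg (Nat.cast_nonneg _) (hc0 k),
    fun k v => key k _ (hle k) v, fun k v => key k _ (fun i j => ?_) v⟩
  rw [← transpose_nonsing_inv, ← transpose_pow]
  exact hle k j i

theorem tendsto_inv_pow_mulVec (hR : IsExpansive R) (v : Fin d → ℝ) :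
    Tendsto (fun k => (((realMat R)ᵀ)⁻¹ ^ k) *ᵥ v) atTop (𝓝 0) := by
  obtain ⟨c, hc, -, -, hle⟩ := exists_summable_inv_pow_mulVec_le hR
  exact squeeze_zero_norm (fun k => hle k v) (by simpa using hc.tendsto_atTop_zero.mul_const ‖v‖)

/-! ### Exponentials and the mask -/

theorem toReal_add (v w : Fin d → ℤ) : toReal (v + w) = toReal v + toReal w := by
  ext; simp [toReal]

theorem toReal_sub (v w : Fin d → ℤ) : toReal (v - w) = toReal v - toReal w := by
  ext; simp [toReal]

@[simp] theorem toReal_zero : toReal (0 : Fin d → ℤ) = 0 := by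
  ext; simp [toReal]

theorem toReal_injective : Function.Injective (toReal : (Fin d → ℤ) → Fin d → ℝ) := by
  intro v w h
  ext i
  simpa [toReal] using congrFun h i

theorem toReal_dotProduct (v w : Fin d → ℤ) : toReal v ⬝ᵥ toReal w = ((v ⬝ᵥ w : ℤ) : ℝ) := by
  simp [toReal, dotProduct]

theorem transpose_mulVec_toReal (v : Fin d → ℤ) :
    (realMat R)ᵀ *ᵥ toReal v = toReal (Rᵀ *ᵥ v) := by
  ext i
  simp [toReal, realMat, mulVec, dotProduct]

theorem expFun_add_right (ξ x y : Fin d → ℝ) : expFun ξ (x + y) = expFun ξ x * expFun ξ y := by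
  simp only [expFun, dotProduct_add, ← Complex.exp_add]
  push_cast; ring_nf

theorem expFun_comm (ξ x : Fin d → ℝ) : expFun ξ x = expFun x ξ := by
  simp only [expFun, dotProduct_comm]

theorem expFun_add_left (ξ η x : Fin d → ℝ) : expFun (ξ + η) x = expFun ξ x * expFun η x := by
  rw [expFun_comm, expFun_add_right, expFun_comm, expFun_comm x η]

@[simp] theorem expFun_zero_left (x : Fin d → ℝ) : expFun 0 x = 1 := by
  simp [expFun]

@[simp] theorem expFun_zero_right (x : Fin d → ℝ) : expFun x 0 = 1 := by
  simp [expFun]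

theorem expFun_neg_left (ξ x : Fin d → ℝ) : expFun (-ξ) x = (starRingEnd ℂ) (expFun ξ x) := by
  simp only [expFun, ← Complex.exp_conj, neg_dotProduct]
  simp [Complex.conj_ofNat]

theorem expFun_eq_one_iff (ξ x : Fin d → ℝ) : expFun ξ x = 1 ↔ ∃ n : ℤ, ξ ⬝ᵥ x = n := by
  rw [expFun, Complex.exp_eq_one_iff]
  have h : (2 * Real.pi * Complex.I : ℂ) ≠ 0 := Complex.two_pi_I_ne_zero
  refine exists_congr fun n => ?_
  rw [mul_comm (n : ℂ), mul_right_inj' h]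
  exact_mod_cast Iff.rfl

theorem continuous_maskFun : Continuous (maskFun B) := by
  unfold maskFun
  refine continuous_const.mul (continuous_finsetSum _ fun b _ => continuous_expFun _)

theorem maskFun_zero (hB : (0 : Fin d → ℤ) ∈ B) : maskFun B 0 = 1 := by
  have : (B.card : ℂ) ≠ 0 := by exact_mod_cast (Finset.card_pos.2 ⟨0, hB⟩).ne'
  simp [maskFun, this]

/-- `x` pairs integrally with all elements of `B`. -/
def IsDualTo (B : Finset (Fin d → ℤ)) (x : Fin d → ℝ) : Prop :=
  ∀ b ∈ B, ∃ n : ℤ, toReal b ⬝ᵥ x = n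

theorem isDualTo_toReal (v : Fin d → ℤ) : IsDualTo B (toReal v) :=
  fun b _ => ⟨b ⬝ᵥ v, toReal_dotProduct b v⟩

theorem IsDualTo.add {x y : Fin d → ℝ} (hx : IsDualTo B x) (hy : IsDualTo B y) :
    IsDualTo B (x + y) := by
  intro b hb
  obtain ⟨m, hm⟩ := hx b hb
  obtain ⟨n, hn⟩ := hy b hb
  exact ⟨m + n, by rw [dotProduct_add, hm, hn]; push_cast; rfl⟩

theorem IsDualTo.neg {x : Fin d → ℝ} (hx : IsDualTo B x) : IsDualTo B (-x) := by
  intro b hb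
  obtain ⟨m, hm⟩ := hx b hb
  exact ⟨-m, by rw [dotProduct_neg, hm]; push_cast; rfl⟩

theorem IsDualTo.sub {x y : Fin d → ℝ} (hx : IsDualTo B x) (hy : IsDualTo B y) :
    IsDualTo B (x - y) := by
  rw [sub_eq_add_neg]; exact hx.add hy.neg

theorem IsDualTo.maskFun_add {y : Fin d → ℝ} (hy : IsDualTo B y) (x : Fin d → ℝ) :
    maskFun B (x + y) = maskFun B x := by
  simp only [maskFun]
  congr 1
  refine Finset.sum_congr rfl fun b hb => ?_
  rw [expFun_add_right, (expFun_eq_one_iff _ _).2 (hy b hb), mul_one]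

theorem IsDualTo.maskFun_eq_one (hB : (0 : Fin d → ℤ) ∈ B) {y : Fin d → ℝ} (hy : IsDualTo B y) :
    maskFun B y = 1 := by
  rw [← zero_add y, hy.maskFun_add, maskFun_zero hB]

/-- An average of unimodular numbers has modulus one only if they all coincide (their variance
vanishes). The term `b = 0` shows that the common value is `1`. -/
theorem isDualTo_of_norm_maskFun_eq_one (hB : (0 : Fin d → ℤ) ∈ B) {x : Fin d → ℝ}
    (h : ‖maskFun B x‖ = 1) : IsDualTo B x := by
  set u := maskFun B x with hu
  have hN : (B.card : ℂ) ≠ 0 := by exact_mod_cast (Finset.card_pos.2 ⟨0, hB⟩).ne'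
  have hsum : ∑ b ∈ B, expFun (toReal b) x = B.card * u := by
    rw [hu, maskFun]; field_simp
  have hzero : ∑ b ∈ B, ‖expFun (toReal b) x - u‖ ^ 2 = 0 := by
    have h1 : ∀ b ∈ B, ‖expFun (toReal b) x - u‖ ^ 2 =
        2 - 2 * (expFun (toReal b) x * (starRingEnd ℂ) u).re := by
      intro b _
      rw [← Complex.normSq_eq_norm_sq, Complex.normSq_sub, Complex.normSq_eq_norm_sq,
        Complex.normSq_eq_norm_sq, norm_expFun, h]
      norm_num
    rw [Finset.sum_congr rfl h1, Finset.sum_sub_distrib, ← Finset.mul_sum, ← Complex.re_sum,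
      ← Finset.sum_mul, hsum, mul_assoc, Complex.mul_conj, Complex.normSq_eq_norm_sq, h]
    simp
    ring
  have heq : ∀ b ∈ B, expFun (toReal b) x = u := by
    intro b hb
    have := (Finset.sum_eq_zero_iff_of_nonneg (fun b _ => by positivity)).1 hzero b hb
    exact sub_eq_zero.1 (norm_eq_zero.1 (pow_eq_zero_iff (two_ne_zero)|>.1 this))
  intro b hb
  rw [← expFun_eq_one_iff, heq b hb, ← heq 0 hB]
  simp

theorem transpose_mulVec_tau (hR : IsExpansive R) (ℓ : Fin d → ℤ) (x : Fin d → ℝ) :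
    (realMat R)ᵀ *ᵥ tau R ℓ x = x + toReal ℓ :=
  transpose_mulVec_inv_mulVec hR _

theorem continuous_tau (ℓ : Fin d → ℤ) : Continuous (tau R ℓ) := by
  unfold tau
  exact Continuous.matrix_mulVec continuous_const (continuous_id.add continuous_const)

/-- The vector `(m_B(τ_ℓ x))_ℓ` is `N^{-1/2} H v`, where `v` has `N` unimodular entries and `H` is
an isometry. -/
theorem IsHadamardTriple.sum_norm_maskFun_tau_sq (hT : IsHadamardTriple R B L) (x : Fin d → ℝ) :
    ∑ ℓ ∈ L, ‖maskFun B (tau R ℓ x)‖ ^ 2 = 1 := by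
  have hNpos : (0 : ℝ) < B.card := by exact_mod_cast Finset.card_pos.2 ⟨0, hT.zero_mem_B⟩
  have hN : (B.card : ℂ) ≠ 0 := by exact_mod_cast hNpos.ne'
  set H := hadamardMatrix R B L with hH
  set s : ℂ := (Real.sqrt (B.card : ℝ) : ℂ) with hs
  have hs2 : s * s = B.card := by
    rw [hs, ← Complex.ofReal_mul, Real.mul_self_sqrt hNpos.le]; simp
  have hs0 : s ≠ 0 := by
    intro h; rw [h, zero_mul] at hs2; exact hN hs2.symm
  let v : {b // b ∈ B} → ℂ := fun b => expFun (toReal b.1) (((realMat R)ᵀ)⁻¹ *ᵥ x)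
  have hm : ∀ ℓ : {ℓ // ℓ ∈ L}, maskFun B (tau R ℓ.1 x) = 1 / s * (H *ᵥ v) ℓ := by
    intro ℓ
    have h1 : (H *ᵥ v) ℓ = 1 / s * ∑ b ∈ B, expFun (toReal b) (tau R ℓ.1 x) := by
      rw [mulVec, dotProduct, Finset.mul_sum, ← Finset.sum_coe_sort B]
      refine Finset.sum_congr rfl fun b _ => ?_
      rw [hH, hadamardMatrix, tau, mulVec_add, expFun_add_right, mul_assoc, mul_comm (v b)]
      congr 2
      rw [expFun, dotProduct_mulVec, ← transpose_nonsing_inv, vecMul_transpose]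
    rw [h1, maskFun, ← mul_assoc]
    congr 1
    rw [← hs2]; field_simp
  have h2 : star (H *ᵥ v) ⬝ᵥ (H *ᵥ v) = B.card := by
    rw [star_mulVec, dotProduct_mulVec, vecMul_vecMul, hT.unitary, vecMul_one, dotProduct]
    have : ∀ b, star v b * v b = 1 := by
      intro b
      have := Complex.normSq_eq_conj_mul_self (z := v b)
      rw [Complex.normSq_eq_norm_sq, norm_expFun] at this
      simpa using this.symm
    rw [Finset.sum_congr rfl fun b _ => this b]
    simp
  have h3 : ((∑ ℓ ∈ L, ‖maskFun B (tau R ℓ x)‖ ^ 2 : ℝ) : ℂ) = 1 := by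
    rw [← Finset.sum_coe_sort L]
    push_cast
    have : ∀ ℓ : {ℓ // ℓ ∈ L}, ((‖maskFun B (tau R ℓ.1 x)‖ : ℂ)) ^ 2 =
        1 / (B.card : ℂ) * (star (H *ᵥ v) ℓ * (H *ᵥ v) ℓ) := by
      intro ℓ
      rw [← Complex.conj_mul', hm ℓ, map_mul, ← hs2]
      have : (starRingEnd ℂ) (1 / s) = 1 / s := by
        rw [hs, map_div₀, Complex.conj_ofReal, map_one]
      rw [this, Pi.star_apply, RCLike.star_def]
      field_simp
    rw [Finset.sum_congr rfl fun ℓ _ => this ℓ, ← Finset.mul_sum]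
    have h4 : ∑ ℓ, star (H *ᵥ v) ℓ * (H *ᵥ v) ℓ = B.card := h2
    rw [h4]
    field_simp
  exact_mod_cast h3

theorem IsHadamardTriple.maskFun_tau_eq_zero (hT : IsHadamardTriple R B L) {x : Fin d → ℝ}
    {ℓ ℓ' : Fin d → ℤ} (hℓ : ℓ ∈ L) (hℓ' : ℓ' ∈ L) (hne : ℓ' ≠ ℓ)
    (h : ‖maskFun B (tau R ℓ x)‖ = 1) : maskFun B (tau R ℓ' x) = 0 := by
  classical
  have h1 := hT.sum_norm_maskFun_tau_sq x
  rw [← Finset.add_sum_erase L _ hℓ, h] at h1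
  have h2 : ∑ k ∈ L.erase ℓ, ‖maskFun B (tau R k x)‖ ^ 2 = 0 := by linarith
  have h3 := (Finset.sum_eq_zero_iff_of_nonneg (fun b _ => by positivity)).1 h2 ℓ'
    (Finset.mem_erase.2 ⟨hne, hℓ'⟩)
  simpa using h3

/-- Start at `x = -ℓ`: since `τ_ℓ x = 0` and `m_B(0) = 1`, no probability is left for the digit
`ℓ'`. -/
theorem IsHadamardTriple.maskFun_inv_mulVec_sub_eq_zero (hT : IsHadamardTriple R B L)
    {ℓ ℓ' : Fin d → ℤ} (hℓ : ℓ ∈ L) (hℓ' : ℓ' ∈ L) (hne : ℓ' ≠ ℓ) :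
    maskFun B (((realMat R)ᵀ)⁻¹ *ᵥ (toReal ℓ' - toReal ℓ)) = 0 := by
  have h := hT.maskFun_tau_eq_zero (x := -toReal ℓ) hℓ hℓ' hne
    (by simp [tau, maskFun_zero hT.zero_mem_B])
  rwa [tau, neg_add_eq_sub] at h

/-! ### Existence of the self-affine measure -/

theorem isProbabilityMeasure_discreteMeasure {A : Finset (Fin d → ℝ)} (hA : A.Nonempty) :
    IsProbabilityMeasure (discreteMeasure A) := by
  refine ⟨?_⟩
  have h : (0 : ℝ) < A.card := by exact_mod_cast hA.card_pos
  simp only [discreteMeasure, Measure.smul_apply, Measure.finsetSum_apply, measure_univ,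
    Finset.sum_const, smul_eq_mul, nsmul_eq_mul, mul_one]
  rw [← ENNReal.ofReal_natCast, ← ENNReal.ofReal_mul (by positivity), one_div,
    inv_mul_cancel₀ h.ne', ENNReal.ofReal_one]

theorem ae_mem_discreteMeasure (A : Finset (Fin d → ℝ)) :
    ∀ᵐ x ∂discreteMeasure A, x ∈ A := by
  rw [ae_iff]
  simp only [discreteMeasure, Measure.smul_apply, Measure.finsetSum_apply, smul_eq_mul]
  rw [Finset.sum_eq_zero, mul_zero]
  intro a ha
  have hs : MeasurableSet {x | x ∉ A} := A.finite_toSet.measurableSet.compl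
  rw [Measure.dirac_apply' a hs]
  simp [ha]

/-- The law of the independent choices of the digits. -/
noncomputable def digitLaw (R : Matrix (Fin d) (Fin d) ℤ) (B : Finset (Fin d → ℤ)) :
    Measure (ℕ → Fin d → ℝ) :=
  Measure.infinitePi fun k => discreteMeasure (scaledDigits R B (k + 1))

theorem isProbabilityMeasure_scaledDigits (hB : B.Nonempty) (k : ℕ) :
    IsProbabilityMeasure (discreteMeasure (scaledDigits R B k)) :=
  isProbabilityMeasure_discreteMeasure (by
    classical
    exact hB.image _)

/-- Realising the convolutions as laws of partial sums on one probability space turns weak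
convergence into almost sure convergence of a series. -/
theorem partialConv_eq_map (hB : B.Nonempty) (n : ℕ) :
    partialConv R B n = (digitLaw R B).map (fun ω => ∑ k ∈ Finset.range n, ω k) := by
  have hP := fun k => isProbabilityMeasure_scaledDigits (R := R) hB (k + 1)
  have : IsProbabilityMeasure (digitLaw R B) := by unfold digitLaw; infer_instance
  induction n with
  | zero => simp [partialConv, Measure.map_const]
  | succ n ih =>
    have hind : ProbabilityTheory.iIndepFun (fun (i : ℕ) (ω : ℕ → Fin d → ℝ) => ω i)
        (digitLaw R B) :=
      ProbabilityTheory.iIndepFun_infinitePi (X := fun _ x => x) fun _ => measurable_id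
    have h1 := hind.indepFun_finsetSum_of_notMem (fun i => measurable_pi_apply i)
      (s := Finset.range n) (i := n) (by simp)
    have h2 : (∑ j ∈ Finset.range n, fun ω : ℕ → Fin d → ℝ => ω j)
        = fun ω => ∑ k ∈ Finset.range n, ω k := by ext; simp
    rw [h2] at h1
    have h3 := h1.map_add_eq_map_conv_map (by fun_prop) (by fun_prop)
    rw [partialConv, ih]
    have h4 : (digitLaw R B).map (fun ω => ω n) = discreteMeasure (scaledDigits R B (n + 1)) :=
      Measure.infinitePi_map_eval _ n
    rw [h4] at h3
    rw [← h3]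
    congr 1
    ext ω i
    simp [Finset.sum_range_succ]

theorem exists_summable_norm_digit_le (hR : IsExpansive R) (B : Finset (Fin d → ℤ)) :
    ∃ c : ℕ → ℝ, Summable c ∧ ∀ k, ∀ x ∈ scaledDigits R B (k + 1), ‖x‖ ≤ c k := by
  obtain ⟨c, hc, hc0, hle, -⟩ := exists_summable_inv_pow_mulVec_le hR
  refine ⟨fun k => c (k + 1) * ∑ b ∈ B, ‖toReal b‖,
    ((summable_nat_add_iff 1).2 hc).mul_right _, fun k x hx => ?_⟩
  classical
  simp only [scaledDigits, Finset.mem_image] at hx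
  obtain ⟨b, hb, rfl⟩ := hx
  refine (hle _ _).trans (mul_le_mul_of_nonneg_left ?_ (hc0 _))
  exact Finset.single_le_sum (f := fun b => ‖toReal b‖) (fun _ _ => norm_nonneg _) hb

/-- The random series is dominated by a summable sequence. It therefore converges almost surely
inside a fixed ball, and dominated convergence gives the weak limit. -/
theorem exists_tendsto_partialConvFinite (hR : IsExpansive R) (hB : B.Nonempty) :
    ∃ μ : FiniteMeasure (Fin d → ℝ), Tendsto (partialConvFinite R B) atTop (𝓝 μ) ∧
      IsProbabilityMeasure (μ : Measure (Fin d → ℝ)) ∧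
      ∃ K : Set (Fin d → ℝ), IsCompact K ∧ (μ : Measure (Fin d → ℝ)) Kᶜ = 0 := by
  have hP := fun k => isProbabilityMeasure_scaledDigits (R := R) hB (k + 1)
  have hPr : IsProbabilityMeasure (digitLaw R B) := by unfold digitLaw; infer_instance
  obtain ⟨c, hc, hle⟩ := exists_summable_norm_digit_le hR B
  have hae : ∀ᵐ ω ∂digitLaw R B, ∀ k, ‖ω k‖ ≤ c k := by
    rw [ae_all_iff]
    intro k
    have h4 : (digitLaw R B).map (fun ω => ω k) = discreteMeasure (scaledDigits R B (k + 1)) :=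
      Measure.infinitePi_map_eval _ k
    have h5 := ae_mem_discreteMeasure (scaledDigits R B (k + 1))
    rw [← h4] at h5
    filter_upwards [ae_of_ae_map (measurable_pi_apply k).aemeasurable h5] with ω hω
    exact hle k _ hω
  have htend : ∀ᵐ ω ∂digitLaw R B,
      Tendsto (fun n => ∑ k ∈ Finset.range n, ω k) atTop (𝓝 (∑' k, ω k)) := by
    filter_upwards [hae] with ω hω
    exact (Summable.of_norm_bounded hc hω).hasSum.tendsto_sum_nat
  have hmeas : AEMeasurable (fun ω : ℕ → Fin d → ℝ => ∑' k, ω k) (digitLaw R B) :=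
    aemeasurable_of_tendsto_metrizable_ae atTop
      (f := fun n (ω : ℕ → Fin d → ℝ) => ∑ k ∈ Finset.range n, ω k)
      (fun n => by fun_prop) htend
  let μ : FiniteMeasure (Fin d → ℝ) := ⟨(digitLaw R B).map fun ω => ∑' k, ω k, inferInstance⟩
  refine ⟨μ, ?_, ?_,
    Metric.closedBall 0 (∑' k, c k), isCompact_closedBall _ _, ?_⟩
  · rw [FiniteMeasure.tendsto_iff_forall_integral_tendsto]
    intro f
    have h1 : ∀ n, ∫ x, f x ∂(partialConvFinite R B n : Measure (Fin d → ℝ)) =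
        ∫ ω, f (∑ k ∈ Finset.range n, ω k) ∂digitLaw R B := by
      intro n
      change ∫ x, f x ∂(partialConv R B n) = _
      rw [partialConv_eq_map hB, integral_map (by fun_prop)
        f.continuous.aestronglyMeasurable]
    simp only [h1]
    change Tendsto _ _ (𝓝 (∫ x, f x ∂((digitLaw R B).map fun ω => ∑' k, ω k)))
    rw [integral_map hmeas f.continuous.aestronglyMeasurable]
    refine tendsto_integral_of_dominated_convergence (fun _ => ‖f‖) (fun n => ?_)
      (integrable_const _) (fun n => ae_of_all _ fun ω => f.norm_coe_le_norm _) ?_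
    · exact f.continuous.comp_aestronglyMeasurable
        (Measurable.aestronglyMeasurable (by fun_prop))
    · filter_upwards [htend] with ω hω
      exact (f.continuous.tendsto _).comp hω
  · exact Measure.isProbabilityMeasure_map hmeas
  · change ((digitLaw R B).map fun ω => ∑' k, ω k) _ = 0
    rw [Measure.map_apply_of_aemeasurable hmeas Metric.isClosed_closedBall.measurableSet.compl]
    have : ∀ᵐ ω ∂digitLaw R B, (∑' k, ω k) ∈ Metric.closedBall (0 : Fin d → ℝ) (∑' k, c k) := by
      filter_upwards [hae] with ω hω
      rw [mem_closedBall_zero_iff]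
      exact tsum_of_norm_bounded hc.hasSum hω
    exact this

theorem selfAffineMeasure_spec (hR : IsExpansive R) (hB : B.Nonempty) :
    Tendsto (partialConvFinite R B) atTop (𝓝 (selfAffineMeasure R B)) ∧
      IsProbabilityMeasure (selfAffineMeasure R B : Measure (Fin d → ℝ)) ∧
      ∃ K : Set (Fin d → ℝ), IsCompact K ∧
        (selfAffineMeasure R B : Measure (Fin d → ℝ)) Kᶜ = 0 := by
  obtain ⟨μ, h1, h2⟩ := exists_tendsto_partialConvFinite hR hB
  have : selfAffineMeasure R B = μ := h1.limUnder_eq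
  rw [this]
  exact ⟨h1, h2⟩

/-! ### The Fourier transform -/

/-- The Fourier transform `ξ ↦ ∫ exp (2πi ⟨ξ, x⟩) dμ(x)`. -/
noncomputable def fourier (μ : Measure (Fin d → ℝ)) (ξ : Fin d → ℝ) : ℂ := ∫ x, expFun ξ x ∂μ

theorem integrable_expFun (μ : Measure (Fin d → ℝ)) [IsFiniteMeasure μ] (ξ : Fin d → ℝ) :
    Integrable (expFun ξ) μ :=
  Integrable.of_bound (continuous_expFun ξ).aestronglyMeasurable 1
    (ae_of_all _ fun x => (norm_expFun ξ x).le)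

theorem fourier_discreteMeasure_scaledDigits (hR : IsExpansive R) (k : ℕ) (ξ : Fin d → ℝ) :
    fourier (discreteMeasure (scaledDigits R B k)) ξ =
      maskFun B ((((realMat R)ᵀ)⁻¹ ^ k) *ᵥ ξ) := by
  classical
  -- `scaledDigits` is an image, so its cardinality and sums match those of `B` only because
  -- distinct digits stay distinct.
  have hinj : Function.Injective fun b : Fin d → ℤ => ((realMat R)⁻¹ ^ k) *ᵥ toReal b := by
    have hu : IsUnit ((realMat R)⁻¹ ^ k) :=
      (((Matrix.isUnit_iff_isUnit_det _).2
        (Matrix.isUnit_nonsing_inv_det _ (isUnit_det_realMat hR)))).pow k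
    exact (Matrix.mulVec_injective_of_isUnit hu).comp toReal_injective
  rw [fourier, discreteMeasure, integral_smul_measure, integral_finsetSum_measure
    fun a _ => integrable_expFun _ _]
  simp only [integral_dirac]
  rw [ENNReal.toReal_ofReal (by positivity), scaledDigits, Finset.card_image_of_injective _ hinj,
    Finset.sum_image fun x _ y _ h => hinj h, maskFun, Complex.real_smul]
  push_cast
  congr 1
  refine Finset.sum_congr rfl fun b _ => ?_
  rw [expFun_comm, expFun, expFun, dotProduct_comm, dotProduct_mulVec, ← mulVec_transpose,
    transpose_pow, transpose_nonsing_inv, dotProduct_comm]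

theorem fourier_conv (μ ν : Measure (Fin d → ℝ)) [IsFiniteMeasure μ] [IsFiniteMeasure ν]
    (ξ : Fin d → ℝ) : fourier (Measure.conv μ ν) ξ = fourier μ ξ * fourier ν ξ := by
  simp only [fourier]
  rw [integral_conv (integrable_expFun _ _)]
  simp only [expFun_add_right, integral_const_mul, integral_mul_const]

theorem fourier_partialConv (hR : IsExpansive R) (n : ℕ) (ξ : Fin d → ℝ) :
    fourier (partialConv R B n) ξ =
      ∏ k ∈ Finset.range n, maskFun B ((((realMat R)ᵀ)⁻¹ ^ (k + 1)) *ᵥ ξ) := by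
  induction n with
  | zero => simp [partialConv, fourier]
  | succ n ih =>
    rw [partialConv, fourier_conv, ih, fourier_discreteMeasure_scaledDigits hR,
      Finset.prod_range_succ]

theorem tendsto_fourier_partialConv (hR : IsExpansive R) (hB : B.Nonempty) (ξ : Fin d → ℝ) :
    Tendsto (fun n => fourier (partialConv R B n) ξ) atTop
      (𝓝 (fourier (selfAffineMeasure R B : Measure (Fin d → ℝ)) ξ)) :=
  (FiniteMeasure.tendsto_iff_forall_integral_rclike_tendsto ℂ).1
    (selfAffineMeasure_spec hR hB).1
    (BoundedContinuousFunction.ofNormedAddCommGroup (expFun ξ) (continuous_expFun ξ) 1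
      fun x => (norm_expFun ξ x).le)

/-- The first factor of the infinite product splits off, and the others form the product at `S⁻¹ξ`.
-/
theorem fourier_selfAffineMeasure (hR : IsExpansive R) (hB : B.Nonempty) (ξ : Fin d → ℝ) :
    fourier (selfAffineMeasure R B : Measure (Fin d → ℝ)) ξ =
      maskFun B (((realMat R)ᵀ)⁻¹ *ᵥ ξ) *
        fourier (selfAffineMeasure R B : Measure (Fin d → ℝ)) (((realMat R)ᵀ)⁻¹ *ᵥ ξ) := by
  have h1 := (tendsto_add_atTop_iff_nat 1).2 (tendsto_fourier_partialConv hR hB ξ)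
  have h2 := (tendsto_fourier_partialConv hR hB (((realMat R)ᵀ)⁻¹ *ᵥ ξ)).const_mul
    (maskFun B (((realMat R)ᵀ)⁻¹ *ᵥ ξ))
  refine tendsto_nhds_unique h1 (h2.congr fun n => ?_)
  rw [fourier_partialConv hR, fourier_partialConv hR, Finset.prod_range_succ', zero_add, pow_one,
    mul_comm]
  congr 1
  refine Finset.prod_congr rfl fun k _ => ?_
  rw [mulVec_mulVec, ← pow_succ]

theorem fourier_zero (μ : Measure (Fin d → ℝ)) [IsProbabilityMeasure μ] : fourier μ 0 = 1 := by
  simp [fourier]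

/-! ### Exponentials in `L²` -/

theorem inner_expLp (μ : Measure (Fin d → ℝ)) [IsFiniteMeasure μ] (ξ η : Fin d → ℝ) :
    inner ℂ (expLp μ ξ) (expLp μ η) = fourier μ (η - ξ) := by
  rw [L2.inner_def, fourier]
  refine integral_congr_ae ?_
  filter_upwards [(memLp_expFun ξ μ).coeFn_toLp, (memLp_expFun η μ).coeFn_toLp] with x h1 h2
  rw [expLp, expLp, h1, h2, sub_eq_add_neg, expFun_add_left, expFun_neg_left]
  simp

theorem norm_expLp (μ : Measure (Fin d → ℝ)) [IsProbabilityMeasure μ] (ξ : Fin d → ℝ) :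
    ‖expLp μ ξ‖ = 1 := by
  have h := inner_expLp μ ξ ξ
  rw [sub_self, fourier_zero, inner_self_eq_norm_sq_to_K] at h
  have h2 : ‖expLp μ ξ‖ ^ 2 = 1 := Complex.ofReal_injective (by push_cast; exact h)
  exact (pow_eq_one_iff_of_nonneg (norm_nonneg _) two_ne_zero).1 h2

theorem continuous_fourier (μ : Measure (Fin d → ℝ)) [IsFiniteMeasure μ] :
    Continuous (fourier μ) := by
  refine continuous_of_dominated (bound := fun _ => 1)
    (fun ξ => (continuous_expFun ξ).aestronglyMeasurable)
    (fun ξ => ae_of_all _ fun x => (norm_expFun ξ x).le) (integrable_const _)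
    (ae_of_all _ fun x => ?_)
  simp only [expFun_comm _ x]
  exact continuous_expFun x

/-! ### Totality of the exponentials -/

/-- The restriction of an exponential to `K`. -/
noncomputable def expRestrict (K : Set (Fin d → ℝ)) (ξ : Fin d → ℝ) : C(K, ℂ) :=
  ⟨fun x => expFun ξ x.1, (continuous_expFun ξ).comp continuous_subtype_val⟩

theorem exists_expFun_ne {x y : Fin d → ℝ} (h : x ≠ y) : ∃ ξ, expFun ξ x ≠ expFun ξ y := by
  obtain ⟨i, hi⟩ := Function.ne_iff.1 h
  have hi' : x i - y i ≠ 0 := sub_ne_zero.2 hi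
  -- This frequency gives `⟨ξ, x - y⟩ = 1/2`, which is not an integer.
  refine ⟨Pi.single i (1 / (2 * (x i - y i))), fun heq => ?_⟩
  set ξ : Fin d → ℝ := Pi.single i (1 / (2 * (x i - y i))) with hξ
  have h1 : expFun ξ (x - y) = 1 := by
    have h2 := expFun_add_right ξ (x - y) y
    rw [sub_add_cancel, heq] at h2
    have h3 : expFun ξ y ≠ 0 := norm_ne_zero_iff.1 (by rw [norm_expFun]; exact one_ne_zero)
    exact (mul_eq_right₀ h3).1 h2.symm
  obtain ⟨n, hn⟩ := (expFun_eq_one_iff _ _).1 h1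
  rw [hξ, single_dotProduct, Pi.sub_apply] at hn
  have h4 : (1 : ℝ) / (2 * (x i - y i)) * (x i - y i) = 1 / 2 := by field_simp
  rw [h4] at hn
  have h5 : (2 * n : ℤ) = 1 := by
    have : (2 * n : ℝ) = 1 := by rw [← hn]; norm_num
    exact_mod_cast this
  omega

/-- Stone–Weierstrass. The exponentials are closed under products and conjugation, so the algebra
they generate is just their span. -/
theorem dense_span_expRestrict (K : Set (Fin d → ℝ)) [CompactSpace K] :
    (Submodule.span ℂ (Set.range (expRestrict K))).topologicalClosure = ⊤ := by
  let A : StarSubalgebra ℂ C(K, ℂ) :=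
    { toSubalgebra := Algebra.adjoin ℂ (Set.range (expRestrict K))
      star_mem' := by
        change Algebra.adjoin ℂ (Set.range (expRestrict K)) ≤
          star (Algebra.adjoin ℂ (Set.range (expRestrict K)))
        refine Algebra.adjoin_le ?_
        rintro - ⟨ξ, rfl⟩
        exact Algebra.subset_adjoin ⟨-ξ, ContinuousMap.ext fun x => expFun_neg_left ξ x.1⟩ }
  have hA : Subalgebra.toSubmodule A.toSubalgebra =
      Submodule.span ℂ (Set.range (expRestrict K)) := by
    apply Algebra.adjoin_eq_span_of_subset
    refine Set.Subset.trans ?_ Submodule.subset_span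
    intro f hf
    refine Submonoid.closure_induction (fun _ => id) ⟨0, ?_⟩ ?_ hf
    · ext x; exact expFun_zero_left _
    · rintro - - - - ⟨ξ, rfl⟩ ⟨η, rfl⟩
      exact ⟨ξ + η, ContinuousMap.ext fun x => expFun_add_left ξ η x.1⟩
  have hsep : A.SeparatesPoints := by
    intro x y hxy
    obtain ⟨ξ, hξ⟩ := exists_expFun_ne (fun h => hxy (Subtype.ext h))
    exact ⟨_, ⟨expRestrict K ξ, Algebra.subset_adjoin ⟨ξ, rfl⟩, rfl⟩, hξ⟩
  have h1 := ContinuousMap.starSubalgebra_topologicalClosure_eq_top_of_separatesPoints A hsep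
  rw [← hA]
  exact congr_arg (Subalgebra.toSubmodule <| StarSubalgebra.toSubalgebra ·) h1

theorem exists_mem_span_expLp (μ : Measure (Fin d → ℝ)) [IsFiniteMeasure μ]
    (K : Set (Fin d → ℝ)) {q : C(K, ℂ)} (hq : q ∈ Submodule.span ℂ (Set.range (expRestrict K))) :
    ∃ p ∈ Submodule.span ℂ (Set.range (expLp μ)), ∀ᵐ x ∂μ, ∀ hx : x ∈ K, p x = q ⟨x, hx⟩ := by
  induction hq using Submodule.span_induction with
  | mem f hf =>
    obtain ⟨ξ, rfl⟩ := hf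
    refine ⟨expLp μ ξ, Submodule.subset_span ⟨ξ, rfl⟩, ?_⟩
    filter_upwards [(memLp_expFun ξ μ).coeFn_toLp] with x hx _
    exact hx
  | zero =>
    refine ⟨0, Submodule.zero_mem _, ?_⟩
    filter_upwards [Lp.coeFn_zero ℂ 2 μ] with x hx _
    rw [hx]; rfl
  | add f g _ _ hf hg =>
    obtain ⟨p, hp, hpf⟩ := hf
    obtain ⟨q, hq, hqg⟩ := hg
    refine ⟨p + q, Submodule.add_mem _ hp hq, ?_⟩
    filter_upwards [hpf, hqg, Lp.coeFn_add p q] with x h1 h2 h3 hx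
    rw [h3, Pi.add_apply, h1 hx, h2 hx]; rfl
  | smul a f _ hf =>
    obtain ⟨p, hp, hpf⟩ := hf
    refine ⟨a • p, Submodule.smul_mem _ a hp, ?_⟩
    filter_upwards [hpf, Lp.coeFn_smul a p] with x h1 h2 hx
    rw [h2, Pi.smul_apply, h1 hx]; rfl

/-- The exponentials are total in `L²(μ)` if `μ` is finite with compact support. -/
theorem topologicalClosure_span_expLp (μ : Measure (Fin d → ℝ)) [IsFiniteMeasure μ]
    {K : Set (Fin d → ℝ)} (hK : IsCompact K) (hμ : μ Kᶜ = 0) :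
    (Submodule.span ℂ (Set.range (expLp μ))).topologicalClosure = ⊤ := by
  have : CompactSpace K := isCompact_iff_compactSpace.1 hK
  rw [eq_top_iff]
  intro f _
  have hdense := BoundedContinuousFunction.toLp_denseRange ℂ μ ℂ (p := 2) (by norm_num)
  refine closure_minimal ?_ (Submodule.isClosed_topologicalClosure _) (hdense f)
  rintro - ⟨g, rfl⟩
  rw [SetLike.mem_coe, ← SetLike.mem_coe, Submodule.topologicalClosure_coe, Metric.mem_closure_iff]
  intro ε hε
  -- `c` bounds the `L²` norm by the uniform norm. Approximating to within `ε / (c + 1)` also covers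
  -- `c = 0`.
  set c : ℝ := (measureUnivNNReal μ : ℝ) ^ (2 : ENNReal).toReal⁻¹ with hc
  have hc0 : 0 ≤ c := by positivity
  have hδ : 0 < ε / (c + 1) := by positivity
  let gK : C(K, ℂ) := ⟨fun x => g x.1, g.continuous.comp continuous_subtype_val⟩
  have hgK : gK ∈ closure (Submodule.span ℂ (Set.range (expRestrict K)) : Set C(K, ℂ)) := by
    rw [← Submodule.topologicalClosure_coe, dense_span_expRestrict]; trivial
  obtain ⟨q, hq, hqd⟩ := Metric.mem_closure_iff.1 hgK _ hδ
  obtain ⟨p, hp, hpq⟩ := exists_mem_span_expLp μ K hq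
  refine ⟨p, hp, ?_⟩
  rw [dist_eq_norm]
  refine (Lp.norm_le_of_ae_bound hδ.le ?_).trans_lt ?_
  · have hKae : ∀ᵐ x ∂μ, x ∈ K := hμ
    filter_upwards [hKae, hpq, Lp.coeFn_sub (BoundedContinuousFunction.toLp 2 μ ℂ g) p,
      BoundedContinuousFunction.coeFn_toLp 2 μ ℂ g] with x hx h1 h2 h3
    rw [h2, Pi.sub_apply, h1 hx, h3]
    have := (ContinuousMap.dist_apply_le_dist (f := gK) (g := q) ⟨x, hx⟩).trans hqd.le
    rwa [dist_eq_norm] at this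
  · rw [← hc, mul_div_assoc', div_lt_iff₀ (by positivity)]
    nlinarith

/-! ### Parseval's criterion -/

/-- The squared distance from `x` to its finite expansion is `‖x‖²` minus a partial Bessel sum, so
reversing Bessel's inequality makes it arbitrarily small. -/
theorem _root_.Orthonormal.mem_closure_span_of_norm_sq_le {E ι : Type*} [NormedAddCommGroup E]
    [InnerProductSpace ℂ E] {v : ι → E} (hv : Orthonormal ℂ v) {x : E}
    (h : ‖x‖ ^ 2 ≤ ∑' i, ‖inner ℂ (v i) x‖ ^ 2) :
    x ∈ (Submodule.span ℂ (Set.range v)).topologicalClosure := by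
  have hdiff : ∀ s : Finset ι, ‖x - ∑ i ∈ s, inner ℂ (v i) x • v i‖ ^ 2 =
      ‖x‖ ^ 2 - ∑ i ∈ s, ‖inner ℂ (v i) x‖ ^ 2 := by
    intro s
    have h2 : (∑ i ∈ s, ∑ j ∈ s, inner ℂ (v i) x * inner ℂ x (v j) * inner ℂ (v j) (v i)) =
        (∑ k ∈ s, inner ℂ (v k) x * inner ℂ x (v k) : ℂ) :=
      hv.inner_left_right_finset
    have h3 : ∀ z : ℂ, RCLike.re (z * (starRingEnd ℂ) z) = ‖z‖ ^ 2 := by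
      intro z
      simp only [RCLike.mul_conj]
      norm_cast
    rw [@norm_sub_sq ℂ, sub_add]
    simp only [@InnerProductSpace.norm_sq_eq_re_inner ℂ E, inner_sum, sum_inner]
    simp only [inner_smul_right, two_mul, inner_smul_left, inner_conj_symm, ← mul_assoc, h2,
      add_sub_cancel_right, sub_right_inj]
    simp only [map_sum, ← inner_conj_symm x, ← h3]
  rw [← SetLike.mem_coe, Submodule.topologicalClosure_coe, Metric.mem_closure_iff]
  intro ε hε
  have hlt : ‖x‖ ^ 2 - ε ^ 2 < ∑' i, ‖inner ℂ (v i) x‖ ^ 2 :=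
    (sub_lt_self _ (by positivity)).trans_le h
  obtain ⟨s, hs⟩ :=
    ((hv.inner_products_summable x).hasSum.eventually (lt_mem_nhds hlt)).exists
  refine ⟨∑ i ∈ s, inner ℂ (v i) x • v i, Submodule.sum_mem _ fun i _ =>
    Submodule.smul_mem _ _ (Submodule.subset_span ⟨i, rfl⟩), ?_⟩
  rw [dist_eq_norm]
  refine lt_of_pow_lt_pow_left₀ 2 hε.le ?_
  rw [hdiff]
  linarith

theorem orthonormal_expLp (μ : Measure (Fin d → ℝ)) [IsProbabilityMeasure μ]
    {Λ : Set (Fin d → ℝ)} (h : ∀ x ∈ Λ, ∀ y ∈ Λ, x ≠ y → fourier μ (x - y) = 0) :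
    Orthonormal ℂ (fun ξ : Λ => expLp μ ξ.1) := by
  refine ⟨fun ξ => norm_expLp μ _, fun ξ η hne => ?_⟩
  change inner ℂ (expLp μ ξ.1) (expLp μ η.1) = 0
  rw [inner_expLp]
  exact h _ η.2 _ ξ.2 fun heq => hne (Subtype.ext heq.symm)

theorem norm_inner_expLp_neg (μ : Measure (Fin d → ℝ)) [IsFiniteMeasure μ] (x ξ : Fin d → ℝ) :
    ‖inner ℂ (expLp μ ξ) (expLp μ (-x))‖ = ‖fourier μ (x + ξ)‖ := by
  rw [← norm_inner_symm, inner_expLp, sub_neg_eq_add, add_comm]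

/-- Parseval's identity for the exponentials suffices for a spectrum. -/
theorem isSpectrum_of_parseval (μ : Measure (Fin d → ℝ)) [IsProbabilityMeasure μ]
    {K : Set (Fin d → ℝ)} (hK : IsCompact K) (hμ : μ Kᶜ = 0) {Λ : Set (Fin d → ℝ)}
    (hΛ : Λ.Countable) (horth : ∀ x ∈ Λ, ∀ y ∈ Λ, x ≠ y → fourier μ (x - y) = 0)
    (h : ∀ x, 1 ≤ ∑' ξ : Λ, ‖fourier μ (x + ξ)‖ ^ 2) : IsSpectrum Λ μ := by
  refine ⟨hΛ, orthonormal_expLp μ horth, ?_⟩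
  rw [eq_top_iff, ← topologicalClosure_span_expLp μ hK hμ]
  refine Submodule.topologicalClosure_minimal _ ?_ (Submodule.isClosed_topologicalClosure _)
  rw [Submodule.span_le]
  rintro - ⟨ξ, rfl⟩
  refine (orthonormal_expLp μ horth).mem_closure_span_of_norm_sq_le ?_
  rw [norm_expLp, one_pow]
  refine (h (-ξ)).trans_eq (tsum_congr fun η => ?_)
  rw [← norm_inner_expLp_neg, neg_neg]

/-! ### Words and cycles -/

theorem inv_mulVec_injective (hR : IsExpansive R) :
    Function.Injective fun x : Fin d → ℝ => ((realMat R)ᵀ)⁻¹ *ᵥ x :=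
  Function.LeftInverse.injective (g := fun x => (realMat R)ᵀ *ᵥ x)
    fun x => transpose_mulVec_inv_mulVec hR x

theorem tauWord_sub (w : List (Fin d → ℤ)) (x y : Fin d → ℝ) :
    tauWord R w x - tauWord R w y = (((realMat R)ᵀ)⁻¹ ^ w.length) *ᵥ (x - y) := by
  induction w with
  | nil => simp [tauWord]
  | cons ℓ w ih =>
    have h : ∀ z, tauWord R (ℓ :: w) z = tau R ℓ (tauWord R w z) := fun z => rfl
    rw [h, h, tau, tau, ← mulVec_sub, add_sub_add_right_eq_sub, ih, mulVec_mulVec,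
      List.length_cons, pow_succ']

/-- `τ_w` need not contract the sup norm. But the difference of two fixed points is fixed by
arbitrarily high powers of `S⁻¹`, which send it to `0`. -/
theorem eq_of_tauWord_eq_self (hR : IsExpansive R) {w : List (Fin d → ℤ)} (hw : w ≠ [])
    {x y : Fin d → ℝ} (hx : tauWord R w x = x) (hy : tauWord R w y = y) : x = y := by
  have h1 : (((realMat R)ᵀ)⁻¹ ^ w.length) *ᵥ (x - y) = x - y := by
    rw [← tauWord_sub, hx, hy]
  have h2 : ∀ n : ℕ, (((realMat R)ᵀ)⁻¹ ^ (w.length * n)) *ᵥ (x - y) = x - y := by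
    intro n
    induction n with
    | zero => simp
    | succ n ih => rw [Nat.mul_succ, pow_add, ← mulVec_mulVec, h1, ih]
  have h3 : Tendsto (fun n => w.length * n) atTop atTop :=
    tendsto_id.const_mul_atTop' (List.length_pos_iff.2 hw)
  have h4 := (tendsto_inv_pow_mulVec hR (x - y)).comp h3
  simp only [Function.comp_def, h2] at h4
  exact sub_eq_zero.1 (tendsto_nhds_unique tendsto_const_nhds h4)

theorem IsCycle.finite {C : Set (Fin d → ℝ)} (hC : IsCycle R L C) : C.Finite := by
  obtain ⟨w, -, -, x₀, -, rfl⟩ := hC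
  refine (w.tails.finite_toSet.image fun v => tauWord R v x₀).subset ?_
  rintro - ⟨v, hv, rfl⟩
  exact ⟨v, (List.mem_tails _ _).2 hv, rfl⟩

theorem IsCycle.nonempty {C : Set (Fin d → ℝ)} (hC : IsCycle R L C) : C.Nonempty := by
  obtain ⟨w, -, -, x₀, -, rfl⟩ := hC
  exact ⟨_, w, List.suffix_rfl, rfl⟩

theorem IsCycle.exists_succ {C : Set (Fin d → ℝ)} (hC : IsCycle R L C) {c : Fin d → ℝ}
    (hc : c ∈ C) : ∃ ℓ ∈ L, tau R ℓ c ∈ C := by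
  obtain ⟨w, hw, hwL, x₀, hx₀, rfl⟩ := hC
  have key : ∀ v, v <:+ w → v ≠ w → ∃ ℓ ∈ L, ∃ v', v' <:+ w ∧
      tau R ℓ (tauWord R v x₀) = tauWord R v' x₀ := by
    rintro v ⟨u, rfl⟩ hne
    have hu : u ≠ [] := by rintro rfl; exact hne rfl
    obtain ⟨u', ℓ, rfl⟩ := List.eq_nil_or_concat u |>.resolve_left hu
    exact ⟨ℓ, hwL ℓ (by simp), ℓ :: v, ⟨u', by simp⟩, rfl⟩
  obtain ⟨v, hv, rfl⟩ := hc
  -- The cycle closes up here: the suffixes `w` and `[]` give the same point.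
  by_cases hvw : v = w
  · obtain ⟨ℓ, hℓ, v', hv', h⟩ := key [] List.nil_suffix (Ne.symm hw)
    refine ⟨ℓ, hℓ, v', hv', ?_⟩
    rw [hvw, hx₀]; exact h
  · obtain ⟨ℓ, hℓ, v', hv', h⟩ := key v hv hvw
    exact ⟨ℓ, hℓ, v', hv', h⟩

theorem IsCycle.exists_pred {C : Set (Fin d → ℝ)} (hC : IsCycle R L C) {c : Fin d → ℝ}
    (hc : c ∈ C) : ∃ ℓ ∈ L, ∃ c' ∈ C, tau R ℓ c' = c := by
  obtain ⟨w, hw, hwL, x₀, hx₀, rfl⟩ := hC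
  have key : ∀ v, v <:+ w → v ≠ [] → ∃ ℓ ∈ L, ∃ v', v' <:+ w ∧
      tau R ℓ (tauWord R v' x₀) = tauWord R v x₀ := by
    rintro v hv hne
    obtain ⟨ℓ, v', rfl⟩ := List.exists_cons_of_ne_nil hne
    exact ⟨ℓ, hwL ℓ (hv.subset (by simp)), v', (List.suffix_cons ℓ v').trans hv, rfl⟩
  obtain ⟨v, hv, rfl⟩ := hc
  by_cases hv0 : v = []
  · obtain ⟨ℓ, hℓ, v', hv', h⟩ := key w List.suffix_rfl hw
    exact ⟨ℓ, hℓ, _, ⟨v', hv', rfl⟩, by rw [h, hx₀, hv0]; rfl⟩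
  · obtain ⟨ℓ, hℓ, v', hv', h⟩ := key v hv hv0
    exact ⟨ℓ, hℓ, _, ⟨v', hv', rfl⟩, h⟩

/-- A cycle point is determined by its word and a suffix, since the fixed point is unique. -/
theorem countable_isExtremeCyclePoint (hR : IsExpansive R) :
    {c | IsExtremeCyclePoint R B L c}.Countable := by
  have hsub : {c | IsExtremeCyclePoint R B L c} ⊆
      ⋃ w : List (Fin d → ℤ), ⋃ v : List (Fin d → ℤ),
        {c | w ≠ [] ∧ ∃ x₀, tauWord R w x₀ = x₀ ∧ c = tauWord R v x₀} := by
    rintro c ⟨C, ⟨⟨w, hw, -, x₀, hx₀, rfl⟩, -⟩, v, -, rfl⟩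
    exact Set.mem_iUnion₂.2 ⟨w, v, hw, x₀, hx₀, rfl⟩
  refine Set.Countable.mono hsub (Set.countable_iUnion fun w => Set.countable_iUnion fun v => ?_)
  refine Set.Subsingleton.countable ?_
  rintro - ⟨hw, x, hx, rfl⟩ - ⟨-, y, hy, rfl⟩
  rw [eq_of_tauWord_eq_self hR hw hx hy]

theorem IsExtremeCycle.isDualTo (hB : (0 : Fin d → ℤ) ∈ B) {C : Set (Fin d → ℝ)}
    (hC : IsExtremeCycle R B L C) {c : Fin d → ℝ} (hc : c ∈ C) : IsDualTo B c :=
  isDualTo_of_norm_maskFun_eq_one hB (hC.2 c hc)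

/-! ### The set generated by the extreme cycles -/

theorem neg_mem_generatedSet {C : Set (Fin d → ℝ)} (hC : IsExtremeCycle R B L C)
    {c : Fin d → ℝ} (hc : c ∈ C) : -c ∈ generatedSet R B L :=
  fun _ hS => hS.1 C hC c hc

theorem mulVec_add_mem_generatedSet {x : Fin d → ℝ} (hx : x ∈ generatedSet R B L)
    {ℓ : Fin d → ℤ} (hℓ : ℓ ∈ L) : (realMat R)ᵀ *ᵥ x + toReal ℓ ∈ generatedSet R B L :=
  fun S hS => hS.2 x (hx S hS) ℓ hℓ

theorem generatedSet_induction {P : (Fin d → ℝ) → Prop}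
    (hneg : ∀ C, IsExtremeCycle R B L C → ∀ c ∈ C, P (-c))
    (hstep : ∀ x ∈ generatedSet R B L, P x → ∀ ℓ ∈ L, P ((realMat R)ᵀ *ᵥ x + toReal ℓ))
    {x : Fin d → ℝ} (hx : x ∈ generatedSet R B L) : P x :=
  (hx {x | x ∈ generatedSet R B L ∧ P x}
    ⟨fun C hC c hc => ⟨neg_mem_generatedSet hC hc, hneg C hC c hc⟩,
      fun x hx ℓ hℓ => ⟨mulVec_add_mem_generatedSet hx.1 hℓ, hstep x hx.1 hx.2 ℓ hℓ⟩⟩).2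

theorem generatedSet_eq_explicitSet : generatedSet R B L = explicitSet R B L := by
  apply Set.Subset.antisymm
  · intro x hx
    refine generatedSet_induction (P := fun x => x ∈ explicitSet R B L) ?_ ?_ hx
    · intro C hC c hc
      exact ⟨0, Fin.elim0, c, fun k => k.elim0, ⟨C, hC, hc⟩, by simp⟩
    · rintro x - ⟨n, ℓs, c, hℓs, hc, rfl⟩ ℓ hℓ
      refine ⟨n + 1, Fin.cons ℓ ℓs, c, fun k => ?_, hc, ?_⟩
      · refine Fin.cases ?_ (fun k => ?_) k
        · simpa using hℓ
        · simpa using hℓs k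
      · rw [Fin.sum_univ_succ, mulVec_add, mulVec_sum]
        simp only [mulVec_mulVec, ← pow_succ', Fin.val_succ, Fin.cons_succ, Fin.cons_zero,
          Fin.val_zero, pow_zero, one_mulVec]
        abel
  · rintro x ⟨n, ℓs, c, hℓs, ⟨C, hC, hc⟩, rfl⟩
    induction n with
    | zero => simpa using neg_mem_generatedSet hC hc
    | succ n ih =>
      have h := mulVec_add_mem_generatedSet (ih (fun k => ℓs k.succ) fun k => hℓs _) (hℓs 0)
      convert h using 1
      rw [Fin.sum_univ_succ, mulVec_add, mulVec_sum]
      simp only [mulVec_mulVec, ← pow_succ', Fin.val_succ, Fin.val_zero, pow_zero, one_mulVec]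
      abel

theorem countable_generatedSet (hR : IsExpansive R) : (generatedSet R B L).Countable := by
  rw [generatedSet_eq_explicitSet]
  have hsub : explicitSet R B L ⊆ ⋃ (n : ℕ), ⋃ (ℓ : Fin n → (Fin d → ℤ)),
      (fun c => (∑ k : Fin n, ((realMat R)ᵀ ^ (k : ℕ)) *ᵥ (toReal (ℓ k))) +
        ((realMat R)ᵀ ^ n) *ᵥ (-c)) '' {c | IsExtremeCyclePoint R B L c} := by
    rintro - ⟨n, ℓ, c, -, hc, rfl⟩
    exact Set.mem_iUnion₂.2 ⟨n, ℓ, c, hc, rfl⟩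
  exact Set.Countable.mono hsub (Set.countable_iUnion fun n => Set.countable_iUnion fun ℓ =>
    (countable_isExtremeCyclePoint hR).image _)

theorem isDualTo_pow_mulVec_toReal (n : ℕ) (v : Fin d → ℤ) :
    IsDualTo B (((realMat R)ᵀ ^ n) *ᵥ toReal v) := by
  induction n generalizing v with
  | zero => simpa using isDualTo_toReal v
  | succ n ih => rw [pow_succ, ← mulVec_mulVec, transpose_mulVec_toReal]; exact ih _

theorem IsHadamardTriple.isDualTo_of_mem_generatedSet (hT : IsHadamardTriple R B L)
    {x : Fin d → ℝ} (hx : x ∈ generatedSet R B L) : IsDualTo B x := by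
  -- Duality to `B` alone is not preserved by `S`, so the induction carries all powers. On a cycle,
  -- `S c` is the predecessor of `c` plus a digit.
  have key : ∀ n : ℕ, IsDualTo B (((realMat R)ᵀ ^ n) *ᵥ x) := by
    refine generatedSet_induction (P := fun x => ∀ n : ℕ, IsDualTo B (((realMat R)ᵀ ^ n) *ᵥ x))
      ?_ ?_ hx
    · intro C hC c hc n
      rw [mulVec_neg]
      refine IsDualTo.neg ?_
      induction n generalizing c with
      | zero => simpa using hC.isDualTo hT.zero_mem_B hc
      | succ n ih =>
        obtain ⟨ℓ, hℓ, c', hc', rfl⟩ := hC.1.exists_pred hc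
        rw [pow_succ, ← mulVec_mulVec, transpose_mulVec_tau hT.expansive, mulVec_add]
        exact (ih c' hc').add (isDualTo_pow_mulVec_toReal n ℓ)
    · intro x _ ih ℓ _ n
      rw [mulVec_add, mulVec_mulVec, ← pow_succ]
      exact (ih _).add (isDualTo_pow_mulVec_toReal n ℓ)
  simpa using key 0

/-- The digit expansion of a point of the generated set runs through finitely many points. -/
theorem IsHadamardTriple.exists_finite_expansion (hT : IsHadamardTriple R B L) {x : Fin d → ℝ}
    (hx : x ∈ generatedSet R B L) :
    ∃ F : Set (Fin d → ℝ), F.Finite ∧ F ⊆ generatedSet R B L ∧ x ∈ F ∧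
      ∀ y ∈ F, ∃ ℓ ∈ L, ∃ z ∈ F, y = (realMat R)ᵀ *ᵥ z + toReal ℓ := by
  refine generatedSet_induction (P := fun x => ∃ F : Set (Fin d → ℝ), F.Finite ∧
    F ⊆ generatedSet R B L ∧ x ∈ F ∧
      ∀ y ∈ F, ∃ ℓ ∈ L, ∃ z ∈ F, y = (realMat R)ᵀ *ᵥ z + toReal ℓ) ?_ ?_ hx
  · intro C hC c hc
    refine ⟨(fun c => -c) '' C, hC.1.finite.image _, ?_, ⟨c, hc, rfl⟩, ?_⟩
    · rintro - ⟨c, hc, rfl⟩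
      exact neg_mem_generatedSet hC hc
    · rintro - ⟨c, hc, rfl⟩
      obtain ⟨ℓ, hℓ, hc'⟩ := hC.1.exists_succ hc
      refine ⟨ℓ, hℓ, _, ⟨_, hc', rfl⟩, ?_⟩
      simp only [mulVec_neg, transpose_mulVec_tau hT.expansive]
      abel
  · rintro x hx ⟨F, hF, hFΛ, hxF, hstep⟩ ℓ hℓ
    refine ⟨insert ((realMat R)ᵀ *ᵥ x + toReal ℓ) F, hF.insert _, ?_, Set.mem_insert _ _, ?_⟩
    · exact Set.insert_subset (mulVec_add_mem_generatedSet hx hℓ) hFΛ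
    · rintro y (rfl | hy)
      · exact ⟨ℓ, hℓ, x, Set.mem_insert_of_mem _ hxF, rfl⟩
      · obtain ⟨k, hk, z, hz, rfl⟩ := hstep y hy
        exact ⟨k, hk, z, Set.mem_insert_of_mem _ hz, rfl⟩

theorem inv_mulVec_sub_eq (hR : IsExpansive R) (y y' : Fin d → ℝ) (ℓ ℓ' : Fin d → ℤ) :
    ((realMat R)ᵀ)⁻¹ *ᵥ (((realMat R)ᵀ *ᵥ y + toReal ℓ) - ((realMat R)ᵀ *ᵥ y' + toReal ℓ')) =
      ((realMat R)ᵀ)⁻¹ *ᵥ (toReal ℓ - toReal ℓ') + (y - y') := by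
  simp only [mulVec_sub, mulVec_add, inv_mulVec_transpose_mulVec hR]
  abel

/-- The periods `y`, `y'` drop out, leaving `m_B(S⁻¹(ℓ - ℓ'))`, which vanishes for distinct digits.
-/
theorem IsHadamardTriple.digit_eq (hT : IsHadamardTriple R B L) {y y' : Fin d → ℝ}
    (hy : IsDualTo B y) (hy' : IsDualTo B y') {ℓ ℓ' : Fin d → ℤ} (hℓ : ℓ ∈ L) (hℓ' : ℓ' ∈ L)
    (h : maskFun B (((realMat R)ᵀ)⁻¹ *ᵥ
      (((realMat R)ᵀ *ᵥ y + toReal ℓ) - ((realMat R)ᵀ *ᵥ y' + toReal ℓ'))) ≠ 0) : ℓ = ℓ' := by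
  by_contra hne
  refine h ?_
  rw [inv_mulVec_sub_eq hT.expansive, (hy.sub hy').maskFun_add]
  exact hT.maskFun_inv_mulVec_sub_eq_zero hℓ' hℓ hne

/-- The map `(ℓ, γ) ↦ Rᵀ γ + ℓ` is a bijection of `L × Λ` onto `Λ`. -/
theorem IsHadamardTriple.bijective_mulVec_add (hT : IsHadamardTriple R B L) :
    Function.Bijective fun p : {ℓ // ℓ ∈ L} × generatedSet R B L =>
      (⟨(realMat R)ᵀ *ᵥ p.2.1 + toReal p.1.1, mulVec_add_mem_generatedSet p.2.2 p.1.2⟩ :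
        generatedSet R B L) := by
  constructor
  · rintro ⟨⟨ℓ, hℓ⟩, ⟨y, hy⟩⟩ ⟨⟨ℓ', hℓ'⟩, ⟨y', hy'⟩⟩ h
    have h1 : (realMat R)ᵀ *ᵥ y + toReal ℓ = (realMat R)ᵀ *ᵥ y' + toReal ℓ' :=
      congrArg Subtype.val h
    have h2 : ℓ = ℓ' := hT.digit_eq (hT.isDualTo_of_mem_generatedSet hy)
      (hT.isDualTo_of_mem_generatedSet hy') hℓ hℓ' (by
        rw [h1, sub_self, mulVec_zero, maskFun_zero hT.zero_mem_B]; exact one_ne_zero)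
    subst h2
    have h3 := congrArg (fun x => ((realMat R)ᵀ)⁻¹ *ᵥ x) (add_right_cancel h1)
    simp only [inv_mulVec_transpose_mulVec hT.expansive] at h3
    subst h3
    rfl
  · rintro ⟨x, hx⟩
    obtain ⟨F, -, hFΛ, hxF, hstep⟩ := hT.exists_finite_expansion hx
    obtain ⟨ℓ, hℓ, z, hz, rfl⟩ := hstep x hxF
    exact ⟨⟨⟨ℓ, hℓ⟩, ⟨z, hFΛ hz⟩⟩, rfl⟩

/-- The exponentials with frequencies in the generated set are mutually orthogonal. -/
theorem IsHadamardTriple.fourier_sub_eq_zero (hT : IsHadamardTriple R B L) {x y : Fin d → ℝ}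
    (hx : x ∈ generatedSet R B L) (hy : y ∈ generatedSet R B L) (hne : x ≠ y) :
    fourier (selfAffineMeasure R B : Measure (Fin d → ℝ)) (x - y) = 0 := by
  by_contra hxy
  obtain ⟨F, hF, hFΛ, hxF, hstep⟩ := hT.exists_finite_expansion hx
  obtain ⟨G, hG, hGΛ, hyG, hstep'⟩ := hT.exists_finite_expansion hy
  have key : ∀ n : ℕ, ∃ p ∈ F, ∃ q ∈ G,
      fourier (selfAffineMeasure R B : Measure (Fin d → ℝ)) (p - q) ≠ 0 ∧
      (((realMat R)ᵀ)⁻¹ ^ n) *ᵥ (x - y) = p - q := by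
    intro n
    induction n with
    | zero => exact ⟨x, hxF, y, hyG, hxy, by simp⟩
    | succ n ih =>
      obtain ⟨p, hp, q, hq, hpq, heq⟩ := ih
      obtain ⟨ℓ, hℓ, p', hp', rfl⟩ := hstep p hp
      obtain ⟨ℓ', hℓ', q', hq', rfl⟩ := hstep' q hq
      rw [fourier_selfAffineMeasure hT.expansive ⟨0, hT.zero_mem_B⟩] at hpq
      have h1 : ℓ = ℓ' := hT.digit_eq (hT.isDualTo_of_mem_generatedSet (hFΛ hp'))
        (hT.isDualTo_of_mem_generatedSet (hGΛ hq')) hℓ hℓ' (left_ne_zero_of_mul hpq)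
      subst h1
      have h2 := inv_mulVec_sub_eq hT.expansive p' q' ℓ ℓ
      rw [sub_self, mulVec_zero, zero_add] at h2
      refine ⟨p', hp', q', hq', ?_, ?_⟩
      · rw [h2] at hpq
        exact right_ne_zero_of_mul hpq
      · rw [pow_succ', ← mulVec_mulVec, heq, h2]
  have hfin : (Set.image2 (fun p q => p - q) F G).Finite := hF.image2 _ hG
  have hmem : ∀ n : ℕ, (((realMat R)ᵀ)⁻¹ ^ n) *ᵥ (x - y) ∈ Set.image2 (fun p q => p - q) F G := by
    intro n
    obtain ⟨p, hp, q, hq, -, h⟩ := key n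
    exact ⟨p, hp, q, hq, h.symm⟩
  have hpow : ∀ n : ℕ, (((realMat R)ᵀ)⁻¹ ^ n) *ᵥ (x - y) ≠ 0 := by
    intro n
    induction n with
    | zero => simpa using sub_ne_zero.2 hne
    | succ n ih =>
      rw [pow_succ', ← mulVec_mulVec]
      intro h
      exact ih (inv_mulVec_injective hT.expansive (by simpa using h))
  -- A sequence of nonzero points of a finite set cannot tend to `0`.
  have hopen : IsOpen (Set.image2 (fun p q => p - q) F G \ {0})ᶜ :=
    (hfin.subset Set.sdiff_subset).isClosed.isOpen_compl
  obtain ⟨n, hn⟩ := ((tendsto_inv_pow_mulVec hT.expansive (x - y)).eventually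
    (hopen.mem_nhds (by simp))).exists
  exact hn ⟨hmem n, hpow n⟩

/-! ### Compact invariant sets -/

theorem isInvariant_sInter {c : Set (Set (Fin d → ℝ))} (h : ∀ K ∈ c, IsInvariant R B L K) :
    IsInvariant R B L (⋂₀ c) :=
  ⟨isClosed_sInter fun K hK => (h K hK).1,
    fun x hx ℓ hℓ hpos K hK => (h K hK).2 x (hx K hK) ℓ hℓ hpos⟩

theorem exists_isMinimalCompactInvariant {K : Set (Fin d → ℝ)} (hne : K.Nonempty)
    (hK : IsCompact K) (hinv : IsInvariant R B L K) :
    ∃ M ⊆ K, IsMinimalCompactInvariant R B L M := by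
  obtain ⟨M, hMK, hM⟩ := zorn_superset_nonempty
    {K : Set (Fin d → ℝ) | K.Nonempty ∧ IsCompact K ∧ IsInvariant R B L K} (by
      intro c hc hchain hcne
      have : Nonempty c := hcne.to_subtype
      have hI := isInvariant_sInter fun K hK => (hc hK).2.2
      refine ⟨⋂₀ c, ⟨?_, ?_, hI⟩, fun s hs => Set.sInter_subset_of_mem hs⟩
      · refine IsCompact.nonempty_sInter_of_directed_nonempty_isCompact_isClosed
          (fun U hU V hV => (hchain.total hU hV).elim (fun h => ⟨U, hU, subset_rfl, h⟩)
            fun h => ⟨V, hV, h, subset_rfl⟩) (fun U hU => (hc hU).1) (fun U hU => (hc hU).2.1)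
          fun U hU => (hc hU).2.1.isClosed
      · obtain ⟨U, hU⟩ := hcne
        exact (hc hU).2.1.of_isClosed_subset hI.1 (Set.sInter_subset_of_mem hU)) K ⟨hne, hK, hinv⟩
  exact ⟨M, hMK, hM.prop, fun K' h1 h2 h3 h4 => hM.eq_of_subset ⟨h1, h2, h3⟩ h4⟩

/-- The closure of the full orbit of `x` under all words works once the orbit is bounded. -/
theorem exists_isCompact_tau_mem (hR : IsExpansive R) (L : Finset (Fin d → ℤ)) (x : Fin d → ℝ) :
    ∃ K : Set (Fin d → ℝ), IsCompact K ∧ x ∈ K ∧ ∀ y ∈ K, ∀ ℓ ∈ L, tau R ℓ y ∈ K := by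
  obtain ⟨c, hc, hc0, -, hle⟩ := exists_summable_inv_pow_mulVec_le hR
  set m : ℝ := ∑ ℓ ∈ L, ‖toReal ℓ‖ with hm
  have hmL : ∀ ℓ ∈ L, ‖toReal ℓ‖ ≤ m := fun ℓ hℓ =>
    Finset.single_le_sum (f := fun ℓ => ‖toReal ℓ‖) (fun _ _ => norm_nonneg _) hℓ
  have hm0 : 0 ≤ m := Finset.sum_nonneg fun _ _ => norm_nonneg _
  set s : ℝ := ∑' k, c k with hs
  set t : ℕ → ℝ := fun j => ∑' k, c (k + j) with ht
  have ht0 : ∀ j, 0 ≤ t j := fun j => tsum_nonneg fun k => hc0 _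
  have hts : ∀ j, t j = c j + t (j + 1) := by
    intro j
    have := ((summable_nat_add_iff j).2 hc).tsum_eq_zero_add
    simp only [zero_add] at this
    simp only [ht, this]
    congr 1
    exact tsum_congr fun k => by rw [add_right_comm, add_assoc]
  -- Bounding all `S⁻ʲ τ_w x` at once lets the induction peel off a letter by passing to `j + 1`.
  -- The letter costs `m * c (j + 1)`, exactly what the tail `t` loses.
  have key : ∀ (w : List (Fin d → ℤ)), (∀ ℓ ∈ w, ℓ ∈ L) → ∀ j,
      ‖(((realMat R)ᵀ)⁻¹ ^ j) *ᵥ tauWord R w x‖ ≤ m * t (j + 1) + s * ‖x‖ := by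
    intro w
    induction w with
    | nil =>
      intro _ j
      have h1 : c j ≤ s := hc.le_tsum j fun k _ => hc0 k
      have h2 := mul_le_mul_of_nonneg_right h1 (norm_nonneg x)
      have h3 := mul_nonneg hm0 (ht0 (j + 1))
      exact (hle j x).trans (by linarith)
    | cons ℓ w ih =>
      intro hw j
      have h1 : (((realMat R)ᵀ)⁻¹ ^ j) *ᵥ tauWord R (ℓ :: w) x =
          (((realMat R)ᵀ)⁻¹ ^ (j + 1)) *ᵥ tauWord R w x +
            (((realMat R)ᵀ)⁻¹ ^ (j + 1)) *ᵥ toReal ℓ := by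
        rw [← mulVec_add, pow_succ, ← mulVec_mulVec]; rfl
      rw [h1, hts (j + 1)]
      refine (norm_add_le _ _).trans ?_
      have h2 := ih (fun k hk => hw k (List.mem_cons_of_mem _ hk)) (j + 1)
      have h3 := (hle (j + 1) (toReal ℓ)).trans
        (mul_le_mul_of_nonneg_left (hmL ℓ (hw ℓ (by simp))) (hc0 (j + 1)))
      linarith
  set W : Set (Fin d → ℝ) := {y | ∃ w : List (Fin d → ℤ), (∀ ℓ ∈ w, ℓ ∈ L) ∧ y = tauWord R w x}
    with hW
  have hbdd : Bornology.IsBounded W := by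
    refine isBounded_iff_forall_norm_le.2 ⟨m * t 1 + s * ‖x‖, ?_⟩
    rintro - ⟨w, hw, rfl⟩
    simpa using key w hw 0
  refine ⟨closure W, hbdd.isCompact_closure,
    subset_closure ⟨[], by simp, rfl⟩, fun y hy ℓ hℓ => ?_⟩
  refine map_mem_closure (continuous_tau ℓ) hy ?_
  rintro - ⟨w, hw, rfl⟩
  exact ⟨ℓ :: w, by simpa using ⟨hℓ, hw⟩, rfl⟩

/-! ### Completeness -/

/-- The sum `∑_{γ ∈ Λ} |μ̂(x + γ)|²` over the set `Λ` generated by the extreme cycles. -/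
noncomputable def spectralSum (R : Matrix (Fin d) (Fin d) ℤ) (B L : Finset (Fin d → ℤ))
    (x : Fin d → ℝ) : ℝ :=
  ∑' γ : generatedSet R B L,
    ‖fourier (selfAffineMeasure R B : Measure (Fin d → ℝ)) (x + γ)‖ ^ 2

theorem IsHadamardTriple.isProbabilityMeasure (hT : IsHadamardTriple R B L) :
    IsProbabilityMeasure (selfAffineMeasure R B : Measure (Fin d → ℝ)) :=
  (selfAffineMeasure_spec hT.expansive ⟨0, hT.zero_mem_B⟩).2.1

/-- Bessel's inequality for the orthonormal exponentials. -/
theorem IsHadamardTriple.summable_spectralSum (hT : IsHadamardTriple R B L) (x : Fin d → ℝ) :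
    Summable fun γ : generatedSet R B L =>
      ‖fourier (selfAffineMeasure R B : Measure (Fin d → ℝ)) (x + γ)‖ ^ 2 := by
  have := hT.isProbabilityMeasure
  have h := (orthonormal_expLp (selfAffineMeasure R B : Measure (Fin d → ℝ))
    fun x hx y hy hne => hT.fourier_sub_eq_zero hx hy hne).inner_products_summable
      (expLp (selfAffineMeasure R B : Measure (Fin d → ℝ)) (-x))
  simpa only [norm_inner_expLp_neg] using h

/-- Split `Λ` into the sets `SΛ + ℓ` and apply the functional equation of `μ̂`. The points of `Λ`
are periods of `m_B`, so the mask factor leaves the inner sum. -/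
theorem IsHadamardTriple.spectralSum_eq (hT : IsHadamardTriple R B L) (x : Fin d → ℝ) :
    spectralSum R B L x =
      ∑ ℓ ∈ L, ‖maskFun B (tau R ℓ x)‖ ^ 2 * spectralSum R B L (tau R ℓ x) := by
  let e := Equiv.ofBijective _ hT.bijective_mulVec_add
  have hsum := (Equiv.summable_iff e).2 (hT.summable_spectralSum x)
  have h0 := hsum.tsum_prod' fun ℓ => hsum.prod_factor ℓ
  simp only [Function.comp_def] at h0
  rw [spectralSum, ← e.tsum_eq, h0, tsum_fintype, ← Finset.sum_coe_sort L]
  refine Finset.sum_congr rfl fun ℓ _ => ?_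
  rw [spectralSum, ← tsum_mul_left]
  refine tsum_congr fun γ => ?_
  have h1 : ((realMat R)ᵀ)⁻¹ *ᵥ (x + ((realMat R)ᵀ *ᵥ γ.1 + toReal ℓ.1)) =
      tau R ℓ.1 x + γ.1 := by
    rw [tau, mulVec_add, mulVec_add, mulVec_add, inv_mulVec_transpose_mulVec hT.expansive]
    abel
  change ‖fourier _ (x + ((realMat R)ᵀ *ᵥ γ.1 + toReal ℓ.1))‖ ^ 2 = _
  rw [fourier_selfAffineMeasure hT.expansive ⟨0, hT.zero_mem_B⟩, h1,
    (hT.isDualTo_of_mem_generatedSet γ.2).maskFun_add, norm_mul, mul_pow]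

theorem IsHadamardTriple.lowerSemicontinuous_spectralSum (hT : IsHadamardTriple R B L) :
    LowerSemicontinuous (spectralSum R B L) := by
  intro x y hy
  obtain ⟨s, hs⟩ := ((hT.summable_spectralSum x).hasSum.eventually (lt_mem_nhds hy)).exists
  have hcont : Continuous fun x => ∑ γ ∈ s,
      ‖fourier (selfAffineMeasure R B : Measure (Fin d → ℝ)) (x + γ)‖ ^ 2 := by
    have := continuous_fourier (selfAffineMeasure R B : Measure (Fin d → ℝ))
    fun_prop
  filter_upwards [hcont.continuousAt.eventually (lt_mem_nhds hs)] with z hz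
  exact hz.trans_le ((hT.summable_spectralSum z).sum_le_tsum s fun _ _ => by positivity)

theorem IsHadamardTriple.one_le_spectralSum (hT : IsHadamardTriple R B L)
    (hS : IsDynamicallySimple R B L) (x : Fin d → ℝ) : 1 ≤ spectralSum R B L x := by
  have := hT.isProbabilityMeasure
  obtain ⟨K, hK, hxK, hKτ⟩ := exists_isCompact_tau_mem hT.expansive L x
  have hlsc := hT.lowerSemicontinuous_spectralSum
  obtain ⟨y, hyK, hy⟩ := (hlsc.lowerSemicontinuousOn K).exists_isMinOn ⟨x, hxK⟩ hK
  set m := spectralSum R B L y with hm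
  have hmin : ∀ z ∈ K, m ≤ spectralSum R B L z := fun z hz => hy hz
  suffices 1 ≤ m from this.trans (hmin x hxK)
  have hclosed : IsClosed (K ∩ {z | spectralSum R B L z ≤ m}) :=
    hK.isClosed.inter (hlsc.isClosed_preimage m)
  have hcompact : IsCompact (K ∩ {z | spectralSum R B L z ≤ m}) :=
    hK.of_isClosed_subset hclosed Set.inter_subset_left
  have hinv : IsInvariant R B L (K ∩ {z | spectralSum R B L z ≤ m}) := by
    refine ⟨hclosed, fun z hz ℓ hℓ hpos => ⟨hKτ z hz.1 ℓ hℓ, ?_⟩⟩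
    -- Minimum principle: a weighted average of values at least `m` is at most `m`, so every value
    -- with positive weight equals `m`.
    have h1 : ∑ k ∈ L, ‖maskFun B (tau R k z)‖ ^ 2 * (spectralSum R B L (tau R k z) - m) ≤ 0 := by
      simp only [mul_sub, Finset.sum_sub_distrib, ← Finset.sum_mul]
      rw [← hT.spectralSum_eq, hT.sum_norm_maskFun_tau_sq, one_mul]
      exact sub_nonpos.2 hz.2
    have h2 : ∀ k ∈ L,
        0 ≤ ‖maskFun B (tau R k z)‖ ^ 2 * (spectralSum R B L (tau R k z) - m) := fun k hk =>
      mul_nonneg (by positivity) (sub_nonneg.2 (hmin _ (hKτ z hz.1 k hk)))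
    have h3 := (Finset.single_le_sum h2 hℓ).trans h1
    have h4 : 0 < ‖maskFun B (tau R ℓ z)‖ ^ 2 := by positivity
    exact sub_nonpos.1 (nonpos_of_mul_nonpos_right h3 h4)
  have hne : (K ∩ {z | spectralSum R B L z ≤ m}).Nonempty := ⟨y, hyK, hm.ge⟩
  obtain ⟨M, hMK, hM⟩ := exists_isMinimalCompactInvariant hne hcompact hinv
  have hC := hS M hM
  obtain ⟨c, hc⟩ := hM.1.1
  refine le_trans ?_ (hMK hc).2
  have h5 := (hT.summable_spectralSum c).le_tsum ⟨-c, neg_mem_generatedSet hC hc⟩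
    fun _ _ => by positivity
  simpa [spectralSum, fourier_zero] using h5

theorem IsHadamardTriple.isSpectrum_generatedSet (hT : IsHadamardTriple R B L)
    (hS : IsDynamicallySimple R B L) :
    IsSpectrum (generatedSet R B L) (selfAffineMeasure R B : Measure (Fin d → ℝ)) := by
  obtain ⟨-, hprob, K, hK, hμ⟩ := selfAffineMeasure_spec hT.expansive ⟨0, hT.zero_mem_B⟩
  exact isSpectrum_of_parseval _ hK hμ (countable_generatedSet hT.expansive)
    (fun x hx y hy hne => hT.fourier_sub_eq_zero hx hy hne)
    fun x => hT.one_le_spectralSum hS x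

/-! ### Finite minimal invariant sets -/

/-- The points reached by a transition from within `M` form a non-empty invariant subset, compact
because `M` is finite, hence all of `M`. -/
theorem IsMinimalCompactInvariant.exists_pred {M : Set (Fin d → ℝ)}
    (hM : IsMinimalCompactInvariant R B L M) (hfin : M.Finite) {y : Fin d → ℝ} (hy : y ∈ M)
    (hstep : ∀ x ∈ M, ∃ ℓ ∈ L, 0 < ‖maskFun B (tau R ℓ x)‖) :
    ∃ x ∈ M, ∃ ℓ ∈ L, 0 < ‖maskFun B y‖ ∧ tau R ℓ x = y := by
  set N : Set (Fin d → ℝ) :=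
    {y ∈ M | ∃ x ∈ M, ∃ ℓ ∈ L, 0 < ‖maskFun B y‖ ∧ tau R ℓ x = y} with hN
  have hNM : N ⊆ M := fun _ h => h.1
  have hNfin : N.Finite := hfin.subset hNM
  have hmem : ∀ x ∈ M, ∀ ℓ ∈ L, 0 < ‖maskFun B (tau R ℓ x)‖ → tau R ℓ x ∈ N :=
    fun x hx ℓ hℓ hpos => ⟨hM.1.2.2.2 x hx ℓ hℓ hpos, x, hx, ℓ, hℓ, hpos, rfl⟩
  obtain ⟨x, hx⟩ := hM.1.1
  obtain ⟨ℓ, hℓ, hpos⟩ := hstep x hx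
  have hNeq : N = M := hM.2 N ⟨_, hmem x hx ℓ hℓ hpos⟩ hNfin.isCompact
    ⟨hNfin.isClosed, fun x hx ℓ hℓ hpos => hmem x (hNM hx) ℓ hℓ hpos⟩ hNM
  rw [← hNeq] at hy
  exact hy.2

theorem IsHadamardTriple.exists_maskFun_tau_pos (hT : IsHadamardTriple R B L) (x : Fin d → ℝ) :
    ∃ ℓ ∈ L, 0 < ‖maskFun B (tau R ℓ x)‖ := by
  by_contra! h
  have h1 := hT.sum_norm_maskFun_tau_sq x
  rw [Finset.sum_eq_zero fun ℓ hℓ => by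
    rw [le_antisymm (h ℓ hℓ) (norm_nonneg _)]; norm_num] at h1
  exact zero_ne_one h1

/-- Points of a finite minimal invariant set have exactly one possible transition: modulo `ℤ^d`,
transitions are inverted by `x ↦ Rᵀ x`, which is a bijection on the image of the set. -/
theorem IsHadamardTriple.transition_unique (hT : IsHadamardTriple R B L) {M : Set (Fin d → ℝ)}
    (hM : IsMinimalCompactInvariant R B L M) (hfin : M.Finite) {x : Fin d → ℝ} (hx : x ∈ M)
    {ℓ ℓ' : Fin d → ℤ} (hℓ : ℓ ∈ L) (hℓ' : ℓ' ∈ L) (h : 0 < ‖maskFun B (tau R ℓ x)‖)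
    (h' : 0 < ‖maskFun B (tau R ℓ' x)‖) : ℓ = ℓ' := by
  let Z : AddSubgroup (Fin d → ℝ) :=
    { carrier := Set.range toReal
      zero_mem' := ⟨0, toReal_zero⟩
      add_mem' := by
        rintro - - ⟨v, rfl⟩ ⟨w, rfl⟩
        exact ⟨v + w, toReal_add v w⟩
      neg_mem' := by
        rintro - ⟨v, rfl⟩
        exact ⟨-v, by rw [← zero_sub, toReal_sub, toReal_zero, zero_sub]⟩ }
  let A : (Fin d → ℝ) →+ (Fin d → ℝ) := (Matrix.mulVecLin (realMat R)ᵀ).toAddMonoidHom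
  let σ : (Fin d → ℝ) ⧸ Z →+ (Fin d → ℝ) ⧸ Z := QuotientAddGroup.map Z Z A (by
    rintro - ⟨v, rfl⟩
    exact ⟨Rᵀ *ᵥ v, (transpose_mulVec_toReal v).symm⟩)
  let π : (Fin d → ℝ) → (Fin d → ℝ) ⧸ Z := fun x => (x : (Fin d → ℝ) ⧸ Z)
  have hσ : ∀ (k : Fin d → ℤ) (z : Fin d → ℝ), σ (π (tau R k z)) = π z := by
    intro k z
    change ((A (tau R k z) : Fin d → ℝ) : (Fin d → ℝ) ⧸ Z) = _
    have : A (tau R k z) = z + toReal k := transpose_mulVec_tau hT.expansive k z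
    rw [this]
    refine (QuotientAddGroup.eq.2 ?_).symm
    rw [neg_add_cancel_left]
    exact ⟨k, rfl⟩
  have hfinπ : (π '' M).Finite := hfin.image π
  have hmaps : Set.MapsTo σ (π '' M) (π '' M) := by
    rintro - ⟨y, hy, rfl⟩
    obtain ⟨z, hz, k, -, -, rfl⟩ := hM.exists_pred hfin hy fun x _ => hT.exists_maskFun_tau_pos x
    exact ⟨z, hz, (hσ k z).symm⟩
  have hsurj : Set.SurjOn σ (π '' M) (π '' M) := by
    rintro - ⟨z, hz, rfl⟩
    obtain ⟨k, hk, hpos⟩ := hT.exists_maskFun_tau_pos z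
    exact ⟨_, ⟨_, hM.1.2.2.2 z hz k hk hpos, rfl⟩, hσ k z⟩
  have hinj : Set.InjOn σ (π '' M) :=
    ((hfinπ.surjOn_iff_bijOn_of_mapsTo hmaps).1 hsurj).injOn
  have heq : π (tau R ℓ x) = π (tau R ℓ' x) :=
    hinj ⟨_, hM.1.2.2.2 x hx ℓ hℓ h, rfl⟩ ⟨_, hM.1.2.2.2 x hx ℓ' hℓ' h', rfl⟩
      (by rw [hσ, hσ])
  -- For distinct digits the integer vector `S⁻¹(ℓ' - ℓ)` would be a zero of `m_B`, whereas `m_B =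
  -- 1` at integer vectors.
  obtain ⟨v, hv⟩ := QuotientAddGroup.eq.1 heq
  by_contra hne
  have h1 := hT.maskFun_inv_mulVec_sub_eq_zero hℓ hℓ' (Ne.symm hne)
  have h2 : ((realMat R)ᵀ)⁻¹ *ᵥ (toReal ℓ' - toReal ℓ) = toReal v := by
    rw [hv, tau, tau, neg_add_eq_sub, ← mulVec_sub, add_sub_add_left_eq_sub]
  rw [h2, (isDualTo_toReal v).maskFun_eq_one hT.zero_mem_B] at h1
  exact one_ne_zero h1

/-- Finite minimal invariant sets are extreme cycles. -/
theorem IsHadamardTriple.isExtremeCycle_of_finite (hT : IsHadamardTriple R B L)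
    {M : Set (Fin d → ℝ)} (hM : IsMinimalCompactInvariant R B L M) (hfin : M.Finite) :
    IsExtremeCycle R B L M := by
  classical
  choose digit hdigit hpos using hT.exists_maskFun_tau_pos
  have huniq : ∀ x ∈ M, ∀ ℓ ∈ L, 0 < ‖maskFun B (tau R ℓ x)‖ → ℓ = digit x :=
    fun x hx ℓ hℓ h => hT.transition_unique hM hfin hx hℓ (hdigit x) h (hpos x)
  set f : (Fin d → ℝ) → Fin d → ℝ := fun x => tau R (digit x) x with hf
  have hfM : ∀ x ∈ M, f x ∈ M := fun x hx => hM.1.2.2.2 x hx _ (hdigit x) (hpos x)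
  have hone : ∀ x ∈ M, ‖maskFun B (f x)‖ = 1 := by
    intro x hx
    have h1 := hT.sum_norm_maskFun_tau_sq x
    rw [Finset.sum_eq_single_of_mem (digit x) (hdigit x)] at h1
    · exact (pow_eq_one_iff_of_nonneg (norm_nonneg _) two_ne_zero).1 h1
    · intro ℓ hℓ hne
      by_contra hcon
      have h2 : 0 < ‖maskFun B (tau R ℓ x)‖ :=
        lt_of_le_of_ne (norm_nonneg _) fun h0 => hcon (by rw [← h0]; norm_num)
      exact hne (huniq x hx ℓ hℓ h2)
  have hiter : ∀ x ∈ M, ∀ n, f^[n] x ∈ M := by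
    intro x hx n
    induction n with
    | zero => exact hx
    | succ n ih => rw [Function.iterate_succ_apply']; exact hfM _ ih
  obtain ⟨x, hx⟩ := hM.1.1
  obtain ⟨i, -, j, -, hij, heq⟩ := Set.infinite_univ.exists_ne_map_eq_of_mapsTo
    (f := fun n : ℕ => f^[n] x) (fun n _ => hiter x hx n) hfin
  wlog hlt : i < j generalizing i j
  · exact this j i hij.symm heq.symm (lt_of_le_of_ne (not_lt.1 hlt) hij.symm)
  set x₀ := f^[i] x with hx₀
  have hx₀M : x₀ ∈ M := hiter x hx i
  set m := j - i with hm
  have hm0 : 0 < m := Nat.sub_pos_of_lt hlt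
  have hper : f^[m] x₀ = x₀ := by
    rw [hx₀, ← Function.iterate_add_apply, hm, Nat.sub_add_cancel hlt.le]
    exact heq.symm
  -- `tauWord` applies the last letter first, so newer digits go in front and suffixes are initial
  -- stretches of the orbit.
  let word : ℕ → List (Fin d → ℤ) := fun n =>
    n.rec [] fun k w => digit (f^[k] x₀) :: w
  have hword : ∀ n, tauWord R (word n) x₀ = f^[n] x₀ := by
    intro n
    induction n with
    | zero => rfl
    | succ n ih =>
      change tau R (digit (f^[n] x₀)) (tauWord R (word n) x₀) = _
      rw [ih, Function.iterate_succ_apply']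
  have hwordL : ∀ n, ∀ ℓ ∈ word n, ℓ ∈ L := by
    intro n
    induction n with
    | zero => intro ℓ hℓ; exact absurd hℓ List.not_mem_nil
    | succ n ih =>
      intro ℓ hℓ
      rcases List.mem_cons.1 hℓ with rfl | h
      · exact hdigit _
      · exact ih ℓ h
  have hsuffix : ∀ n v, v <:+ word n ↔ ∃ k ≤ n, v = word k := by
    intro n
    induction n with
    | zero =>
      intro v
      change v <:+ [] ↔ _
      rw [List.suffix_nil]
      constructor
      · rintro rfl; exact ⟨0, le_rfl, rfl⟩
      · rintro ⟨k, hk, rfl⟩; rw [Nat.le_zero.1 hk]; rfl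
    | succ n ih =>
      intro v
      change v <:+ digit (f^[n] x₀) :: word n ↔ _
      rw [List.suffix_cons_iff, ih]
      constructor
      · rintro (rfl | ⟨k, hk, rfl⟩)
        · exact ⟨n + 1, le_rfl, rfl⟩
        · exact ⟨k, hk.trans n.le_succ, rfl⟩
      · rintro ⟨k, hk, rfl⟩
        rcases Nat.le_succ_iff.1 hk with h | rfl
        · exact Or.inr ⟨k, h, rfl⟩
        · exact Or.inl rfl
  set C : Set (Fin d → ℝ) := {y | ∃ v : List (Fin d → ℤ), v <:+ word m ∧ y = tauWord R v x₀}
    with hC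
  have hCmem : ∀ y, y ∈ C ↔ ∃ k ≤ m, y = f^[k] x₀ := by
    intro y
    constructor
    · rintro ⟨v, hv, rfl⟩
      obtain ⟨k, hk, rfl⟩ := (hsuffix m v).1 hv
      exact ⟨k, hk, hword k⟩
    · rintro ⟨k, hk, rfl⟩
      exact ⟨word k, (hsuffix m _).2 ⟨k, hk, rfl⟩, (hword k).symm⟩
  have hword_ne : word m ≠ [] := by
    intro h
    obtain ⟨n, hn⟩ := Nat.exists_eq_succ_of_ne_zero hm0.ne'
    rw [hn] at h
    exact List.cons_ne_nil _ _ h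
  have hcyc : IsCycle R L C := ⟨word m, hword_ne, hwordL m, x₀, by rw [hword, hper], rfl⟩
  have hCM : C ⊆ M := by
    intro y hy
    obtain ⟨k, -, rfl⟩ := (hCmem y).1 hy
    exact hiter _ hx₀M k
  have hfC : ∀ y ∈ C, f y ∈ C := by
    intro y hy
    obtain ⟨k, hk, rfl⟩ := (hCmem y).1 hy
    rw [hCmem]
    rcases hk.lt_or_eq with hk | rfl
    · exact ⟨k + 1, hk, (Function.iterate_succ_apply' _ _ _).symm⟩
    · exact ⟨1, hm0, by rw [hper]; rfl⟩
  have hCeq : C = M := by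
    refine hM.2 C hcyc.nonempty hcyc.finite.isCompact ⟨hcyc.finite.isClosed, ?_⟩ hCM
    intro y hy ℓ hℓ h
    rw [huniq y (hCM hy) ℓ hℓ h]
    exact hfC y hy
  refine ⟨hCeq ▸ hcyc, fun y hy => ?_⟩
  -- `hone` controls the mask only at images under `f`; every point of `M` is one.
  obtain ⟨z, hz, ℓ, hℓ, hpos', rfl⟩ := hM.exists_pred hfin hy fun x _ =>
    hT.exists_maskFun_tau_pos x
  rw [huniq z hz ℓ hℓ hpos']
  exact hone z hz

/-! ### Dimension one -/

/-- On the line `m_B` is real-analytic and equals `1` at `0`, so its zeros cannot accumulate. -/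
theorem finite_zeros_maskFun {B : Finset (Fin 1 → ℤ)} (hB : (0 : Fin 1 → ℤ) ∈ B) (r : ℝ) :
    {x : Fin 1 → ℝ | ‖x‖ ≤ r ∧ maskFun B x = 0}.Finite := by
  set g : ℝ → ℂ := fun t => maskFun B (fun _ => t) with hg
  have han : AnalyticOnNhd ℝ g Set.univ := by
    intro t _
    have h1 : g = fun t : ℝ => (1 / (B.card : ℂ)) * ∑ b ∈ B,
        Complex.exp (2 * Real.pi * Complex.I * ((b 0 : ℂ) * Complex.ofRealCLM t)) := by
      ext t
      simp [hg, maskFun, expFun, toReal, dotProduct]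
    rw [h1]
    refine analyticAt_const.mul (Finset.analyticAt_fun_sum _ fun b _ => ?_)
    have h2 : AnalyticAt ℝ (fun t : ℝ =>
        2 * Real.pi * Complex.I * ((b 0 : ℂ) * Complex.ofRealCLM t)) t :=
      analyticAt_const.mul (analyticAt_const.mul (Complex.ofRealCLM.analyticAt t))
    exact (analyticAt_cexp.restrictScalars (𝕜 := ℝ)).fun_comp h2
  have hfin : {t : ℝ | t ∈ Set.Icc (-r) r ∧ g t = 0}.Finite := by
    by_contra hinf
    obtain ⟨t, -, ht⟩ := Set.Infinite.exists_accPt_of_subset_isCompact hinf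
      (isCompact_Icc (a := -r) (b := r)) fun t ht => ht.1
    have h1 := accPt_iff_frequently_nhdsNE.1 ht
    have h2 := han.eqOn_zero_of_preconnected_of_frequently_eq_zero isPreconnected_univ
      (Set.mem_univ t) (h1.mono fun s hs => hs.2)
    have h3 : g 0 = 0 := h2 (Set.mem_univ 0)
    have h4 : g 0 = 1 := maskFun_zero hB
    exact zero_ne_one (h3.symm.trans h4)
  refine (hfin.image fun t => (fun _ => t : Fin 1 → ℝ)).subset ?_
  rintro x ⟨hx, h0⟩
  have hx' : (fun _ => x 0 : Fin 1 → ℝ) = x := by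
    ext i; rw [Subsingleton.elim i 0]
  refine ⟨x 0, ⟨?_, ?_⟩, hx'⟩
  · exact abs_le.1 ((norm_le_pi_norm x 0).trans hx)
  · rw [hg]; simp only [hx']; exact h0

theorem tau_zero (x : Fin d → ℝ) : tau R 0 x = ((realMat R)ᵀ)⁻¹ *ᵥ x := by
  simp [tau]

/-- The digit `0` fixes `0` with probability one, so `{0}` is itself invariant. -/
theorem IsHadamardTriple.eq_singleton_zero (hT : IsHadamardTriple R B L) {M : Set (Fin d → ℝ)}
    (hM : IsMinimalCompactInvariant R B L M) (h0 : (0 : Fin d → ℝ) ∈ M) : M = {0} := by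
  refine (hM.2 {0} (Set.singleton_nonempty _) isCompact_singleton
    ⟨isClosed_singleton, ?_⟩ (by simpa using h0)).symm
  rintro x rfl ℓ hℓ hpos
  have h1 : tau R 0 (0 : Fin d → ℝ) = 0 := by rw [tau_zero, mulVec_zero]
  by_cases hℓ0 : ℓ = 0
  · rw [hℓ0, h1]; rfl
  · have h2 := hT.maskFun_tau_eq_zero (x := 0) hT.zero_mem_L hℓ hℓ0
      (by rw [h1, maskFun_zero hT.zero_mem_B, norm_one])
    rw [h2, norm_zero] at hpos
    exact absurd hpos (lt_irrefl _)

/-- Repeating the digit `0` drives any point towards `0`. If `0 ∉ M`, this path must be blocked by a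
zero of `m_B`, so `M` lies in finitely many preimages of finite zero sets. -/
theorem IsHadamardTriple.finite_of_isMinimalCompactInvariant (hT : IsHadamardTriple R B L)
    (hZ : ∀ r, {x : Fin d → ℝ | ‖x‖ ≤ r ∧ maskFun B x = 0}.Finite) {M : Set (Fin d → ℝ)}
    (hM : IsMinimalCompactInvariant R B L M) : M.Finite := by
  by_cases h0 : (0 : Fin d → ℝ) ∈ M
  · rw [hT.eq_singleton_zero hM h0]; exact Set.finite_singleton 0
  obtain ⟨r, hr⟩ := isBounded_iff_forall_norm_le.1 hM.1.2.1.isBounded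
  obtain ⟨c, hc, hc0, -, hle⟩ := exists_summable_inv_pow_mulVec_le hT.expansive
  have hle' : ∀ x ∈ M, ∀ n, ‖(((realMat R)ᵀ)⁻¹ ^ n) *ᵥ x‖ ≤ c n * r := fun x hx n =>
    (hle n x).trans (mul_le_mul_of_nonneg_left (hr x hx) (hc0 n))
  obtain ⟨δ, hδ, hδZ⟩ : ∃ δ > 0, ∀ x : Fin d → ℝ, ‖x‖ < δ → maskFun B x ≠ 0 := by
    have h1 : ∀ᶠ x in 𝓝 (0 : Fin d → ℝ), maskFun B x ≠ 0 :=
      continuous_maskFun.continuousAt.eventually_ne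
        (by rw [maskFun_zero hT.zero_mem_B]; exact one_ne_zero)
    obtain ⟨δ, hδ, h⟩ := Metric.eventually_nhds_iff.1 h1
    exact ⟨δ, hδ, fun x hx => h (by rwa [dist_zero_right])⟩
  have hlim : Tendsto (fun n => c n * r) atTop (𝓝 0) := by
    simpa using hc.tendsto_atTop_zero.mul_const r
  -- From step `n₀` on, the path of every point of `M` is in the ball around `0` free of zeros, so a
  -- block occurs earlier.
  obtain ⟨n₀, hn₀⟩ := eventually_atTop.1 (hlim.eventually (gt_mem_nhds hδ))
  have hinj : ∀ n : ℕ, Function.Injective fun x : Fin d → ℝ => (((realMat R)ᵀ)⁻¹ ^ n) *ᵥ x := by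
    intro n
    exact Matrix.mulVec_injective_of_isUnit (((Matrix.isUnit_iff_isUnit_det _).2
      (Matrix.isUnit_nonsing_inv_det _ (isUnit_det_transpose hT.expansive))).pow n)
  have hsub : M ⊆ ⋃ n ∈ Set.Iio n₀, (fun x : Fin d → ℝ => (((realMat R)ᵀ)⁻¹ ^ n) *ᵥ x) ⁻¹'
      {x | ‖x‖ ≤ c n * r ∧ maskFun B x = 0} := by
    intro x hx
    by_contra hcon
    have hne : ∀ n, maskFun B ((((realMat R)ᵀ)⁻¹ ^ n) *ᵥ x) ≠ 0 := by
      intro n hn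
      rcases lt_or_ge n n₀ with h | h
      · exact hcon (Set.mem_iUnion₂.2 ⟨n, h, hle' x hx n, hn⟩)
      · exact hδZ _ ((hle' x hx n).trans_lt (hn₀ n h)) hn
    have hmem : ∀ n : ℕ, (((realMat R)ᵀ)⁻¹ ^ n) *ᵥ x ∈ M := by
      intro n
      induction n with
      | zero => simpa using hx
      | succ n ih =>
        have h1 : tau R 0 ((((realMat R)ᵀ)⁻¹ ^ n) *ᵥ x) = (((realMat R)ᵀ)⁻¹ ^ (n + 1)) *ᵥ x := by
          rw [tau_zero, mulVec_mulVec, ← pow_succ']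
        rw [← h1]
        refine hM.1.2.2.2 _ ih 0 hT.zero_mem_L (norm_pos_iff.2 ?_)
        rw [h1]
        exact hne _
    exact h0 (hM.1.2.2.1.mem_of_tendsto (tendsto_inv_pow_mulVec hT.expansive x)
      (Eventually.of_forall hmem))
  exact ((Set.finite_Iio n₀).biUnion fun n _ => (hZ _).preimage (hinj n).injOn).subset hsub

theorem IsHadamardTriple.isDynamicallySimple_of_dim_one {R : Matrix (Fin 1) (Fin 1) ℤ}
    {B L : Finset (Fin 1 → ℤ)} (hT : IsHadamardTriple R B L) : IsDynamicallySimple R B L :=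
  fun _ hM => hT.isExtremeCycle_of_finite hM
    (hT.finite_of_isMinimalCompactInvariant (finite_zeros_maskFun hT.zero_mem_B) hM)

end

end Dyn

theorem mainTheorem5 {d : ℕ} (R : Matrix (Fin d) (Fin d) ℤ) (B L : Finset (Fin d → ℤ))
    (hT : Dyn.IsHadamardTriple R B L) :
    -- the infinite convolution converges weakly to a compactly supported probability measure
    (Tendsto (Dyn.partialConvFinite R B) atTop (𝓝 (Dyn.selfAffineMeasure R B)) ∧
      IsProbabilityMeasure (Dyn.selfAffineMeasure R B : Measure (Fin d → ℝ)) ∧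
      ∃ K : Set (Fin d → ℝ), IsCompact K ∧
        (Dyn.selfAffineMeasure R B : Measure (Fin d → ℝ)) Kᶜ = 0) ∧
    (Dyn.IsDynamicallySimple R B L →
      Dyn.IsSpectrum (Dyn.generatedSet R B L)
        (Dyn.selfAffineMeasure R B : Measure (Fin d → ℝ)) ∧
      Dyn.generatedSet R B L = Dyn.explicitSet R B L) ∧
    (d = 1 → Dyn.IsDynamicallySimple R B L) := by
  refine ⟨Dyn.selfAffineMeasure_spec hT.expansive ⟨0, hT.zero_mem_B⟩,
    fun hS => ⟨hT.isSpectrum_generatedSet hS, Dyn.generatedSet_eq_explicitSet⟩, ?_⟩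
  rintro rfl
  exact hT.isDynamicallySimple_of_dim_one
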